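/- Let $q\in\mathbb R$, $t>0$, and let $\{\mu(i,j)\}_{1\le i<j}$ be independent, identically distributed, (almost surely) non-vanishing real random variables on a probability space, with $\mathbb E(\mu(i,j))=q/t$ and $\mathbb E(\mu(i,j)^2)=1$. For each realization put $\mu_{*,*}(i,j)=\mu(i,j)$ for $i<j$, and define the remaining coefficients $\mu_{\epsilon,\epsilon'}(i,j)$ ($\epsilon,\epsilon'\in\{1,*\}$, $i\neq j$) by requiring, for $i<j$, $$\mu_{1,1}(i,j)=\frac1{\mu_{*,*}(i,j)},\quad \mu_{*,1}(i,j)=t\,\mu_{*,*}(i,j),\quad \mu_{1,*}(i,j)=\frac1{\mu_{*,1}(i,j)},\quad \mu_{\epsilon',\epsilon}(j,i)=\frac1{\mu_{\epsilon,\epsilon'}(i,j)}.$$ Then for almost every realization of $\{\mu(i,j)\}_{i<j}$ the following holds. Let $\mathscr A$ be any unital complex $*$-algebra, $\varphi:\mathscr A\to\mathbb C$ a state (a unital positive linear functional), and $b_1,b_2,\ldots\in\mathscr A$ a sequence such that 1. $\varphi(b_i)=\varphi(b_i^*)=\varphi(b_ib_i)=\varphi(b_i^*b_i^*)=\varphi(b_i^*b_i)=0$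 for all $i$; 2. $\varphi(b_i^{\epsilon}b_i^{\epsilon'})=\varphi(b_j^{\epsilon}b_j^{\epsilon'})$ for all $i,j$ and $\epsilon,\epsilon'\in\{1,*\}$ (this common value is written $\varphi(b^{\epsilon}b^{\epsilon'})$); 3. for every $n$ there is a constant $\alpha_n$ with $|\varphi(b_{j(1)}^{\epsilon(1)}\cdots b_{j(n)}^{\epsilon(n)})|\le\alpha_n$ for all $j(1),\ldots,j(n)\in\mathbb N$ and $\epsilon(1),\ldots,\epsilon(n)\in\{1,*\}$; 4. $\varphi$ factors over naturally ordered products: whenever $i_1<\cdots<i_m$ and each $B_k$ is a product $b_{i_k}^{\epsilon_{k,1}}\cdots b_{i_k}^{\epsilon_{k,r_k}}$ with $r_k\ge1$ and $\epsilon_{k,l}\in\{1,*\}$, one has $\varphi(B_1\cdots B_m)=\varphi(B_1)\cdots\varphi(B_m)$; 5. $b_i^{\epsilon}b_j^{\epsilon'}=\mu_{\epsilon',\epsilon}(j,i)\,b_j^{\epsilon'}b_i^{\epsilon}$ for all $i\ne j$ and $\epsilon,\epsilon'\in\{1,*\}$, with the coefficients of the given realization. Put $S_N=(b_1+\cdots+b_N)/\sqrt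 N$. Then every odd $*$-moment of $S_N$ tends to zero: for all $n\ge1$ and $\epsilon(1),\ldots,\epsilon(2n-1)\in\{1,*\}$, $$\lim_{N\to\infty}\varphi(S_N^{\epsilon(1)}\cdots S_N^{\epsilon(2n-1)})=0,$$ and for all $n\ge0$ and $\epsilon(1),\ldots,\epsilon(2n)\in\{1,*\}$, $$\lim_{N\to\infty}\varphi(S_N^{\epsilon(1)}\cdots S_N^{\epsilon(2n)})=\sum_{\mathscr V\in\mathscr P_2(2n)}q^{\mathrm{cr}(\mathscr V)}\,t^{\mathrm{ne}(\mathscr V)}\prod_{i=1}^n\varphi(b^{\epsilon(w_i)}b^{\epsilon(z_i)}).$$ Here $\mathscr P_2(2n)$ is the set of pair partitions $\mathscr V=\{(w_1,z_1),\ldots,(w_n,z_n)\}$ of $\{1,\ldots,2n\}$, written with $w_i<z_i$ and $w_1<\cdots<w_n$; $\mathrm{cr}(\mathscr V)$ is the number of pairs $(i,j)$ with $w_i<w_j<z_i<z_j$ and $\mathrm{ne}(\mathscr V)$ the number of pairs $(i,j)$ with $w_i<w_j<z_j<z_i$. -/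

import Mathlib

open MeasureTheory ProbabilityTheory Filter Topology
open scoped ComplexOrder

universe u v

namespace NCCLT

/-- The exponents `1` and `∗`. -/
inductive Expo where
  | one : Expo
  | adj : Expo

/-- The power `a ^ ε`, i.e. `a` if `ε = 1` and `a∗` if `ε = ∗`. -/
def epow {A : Type*} [Star A] (a : A) : Expo → A
  | Expo.one => a
  | Expo.adj => star a

/-- A state on a unital complex `∗`-algebra: a unital positive linear functional. -/
structure IsState {A : Type*} [Ring A] [StarRing A] [Algebra ℂ A] (φ : A →ₗ[ℂ] ℂ) : Prop where
  map_one : φ 1 = 1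
  nonneg : ∀ a : A, 0 ≤ φ (a * star a)

/-- `φ` factors over the naturally ordered products in `b`. A naturally ordered product is a
concatenation of nonempty blocks, the block `(i, [ε₁, …, ε_k])` being `b_i^ε₁ ⋯ b_i^ε_k`, with
strictly increasing indices `i` from each block to the next. -/
def FactorsOverNaturallyOrdered {A : Type*} [Ring A] [StarRing A] [Algebra ℂ A]
    (φ : A →ₗ[ℂ] ℂ) (b : ℕ → A) : Prop :=
  ∀ L : List (ℕ × List Expo),
    (∀ B ∈ L, B.2 ≠ []) →
    (L.map Prod.fst).Pairwise (· < ·) →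
    φ ((L.map fun B => (B.2.map (epow (b B.1))).prod).prod) =
      (L.map fun B => φ ((B.2.map (epow (b B.1))).prod)).prod

/-- The moment conditions on the sequence `b` (indexed from `0`) in `(A, φ)`. -/
structure MomentCondition {A : Type*} [Ring A] [StarRing A] [Algebra ℂ A]
    (φ : A →ₗ[ℂ] ℂ) (b : ℕ → A) : Prop where
  centred : ∀ i, φ (b i) = 0
  centred_star : ∀ i, φ (star (b i)) = 0
  mul_self : ∀ i, φ (b i * b i) = 0
  star_mul_star : ∀ i, φ (star (b i) * star (b i)) = 0
  star_mul_self : ∀ i, φ (star (b i) * b i) = 0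
  cov_eq : ∀ (i j : ℕ) (e e' : Expo),
    φ (epow (b i) e * epow (b i) e') = φ (epow (b j) e * epow (b j) e')
  bounded : ∀ n : ℕ, ∃ α : ℝ, ∀ (j : Fin n → ℕ) (ε : Fin n → Expo),
    ‖φ (List.ofFn fun k => epow (b (j k)) (ε k)).prod‖ ≤ α
  factors : FactorsOverNaturallyOrdered φ b

/-- `b_i^ε b_j^ε' = c_{ε',ε}(j,i) b_j^ε' b_i^ε` for all `i ≠ j`, where `c ε ε' i j` stands for
the coefficient `c_{ε,ε'}(i,j)`. -/
def CommutationRelation {A : Type*} [Ring A] [StarRing A] [Algebra ℂ A]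
    (c : Expo → Expo → ℕ → ℕ → ℝ) (b : ℕ → A) : Prop :=
  ∀ i j : ℕ, i ≠ j → ∀ e e' : Expo,
    epow (b i) e * epow (b j) e' = ((c e' e j i : ℝ) : ℂ) • (epow (b j) e' * epow (b i) e)

/-- The coefficients `μ_{ε,ε'}(i,j)` for `i < j` in terms of `m = μ_{∗,∗}(i,j)`. -/
noncomputable def upperCoeff (t m : ℝ) : Expo → Expo → ℝ
  | Expo.adj, Expo.adj => m
  | Expo.one, Expo.one => 1 / m
  | Expo.adj, Expo.one => t * m
  | Expo.one, Expo.adj => 1 / (t * m)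

/-- All the coefficients `μ_{ε,ε'}(i,j)`, `i ≠ j`, obtained from the numbers `μ(i,j)`, `i < j`,
using `μ_{ε',ε}(j,i) = 1 / μ_{ε,ε'}(i,j)`. The values at `i = j` play no role. -/
noncomputable def commCoeff (t : ℝ) (μ : ℕ → ℕ → ℝ) (e e' : Expo) (i j : ℕ) : ℝ :=
  if i < j then upperCoeff t (μ i j) e e' else 1 / upperCoeff t (μ j i) e' e

/-- `S_N = (b_1 + ⋯ + b_N) / √N`; the sequence is indexed from `0` here. -/
noncomputable def partialSum {A : Type*} [Ring A] [Algebra ℂ A] (b : ℕ → A) (N : ℕ) : A :=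
  ((1 / Real.sqrt N : ℝ) : ℂ) • ∑ i ∈ Finset.range N, b i

/-- The mixed `∗`-moment `φ(a^ε(1) ⋯ a^ε(r))`. -/
noncomputable def starMoment {A : Type*} [Ring A] [StarRing A] [Algebra ℂ A]
    (φ : A →ₗ[ℂ] ℂ) (a : A) {r : ℕ} (ε : Fin r → Expo) : ℂ :=
  φ (List.ofFn fun k => epow a (ε k)).prod

/-- The pair partitions of an `m`-element ordered set, each given as the set of its blocks
`(w, z)` with `w < z`: every element lies in exactly one block. -/
def pairPartitions (m : ℕ) : Finset (Finset (Fin m × Fin m)) :=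
  Finset.univ.filter fun V =>
    (∀ p ∈ V, p.1 < p.2) ∧ ∀ k : Fin m, (V.filter fun p => p.1 = k ∨ p.2 = k).card = 1

/-- The number of crossings `w < w' < z < z'` with `(w, z), (w', z') ∈ V`. -/
def crossings {m : ℕ} (V : Finset (Fin m × Fin m)) : ℕ :=
  ((V ×ˢ V).filter fun x => x.1.1 < x.2.1 ∧ x.2.1 < x.1.2 ∧ x.1.2 < x.2.2).card

/-- The number of nestings `w < w' < z' < z` with `(w, z), (w', z') ∈ V`. -/
def nestings {m : ℕ} (V : Finset (Fin m × Fin m)) : ℕ :=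
  ((V ×ˢ V).filter fun x => x.1.1 < x.2.1 ∧ x.2.1 < x.2.2 ∧ x.2.2 < x.1.2).card

end NCCLT

/-!
Putting a word in the letters `b_i^ε` into natural order multiplies it by a scalar weight, after
which its moment factors over the distinct indices. By centring, a word contributes only if each of
its indices occurs at least twice, and by boundedness the words in which some index occurs more
often are too few to survive the factor `N ^ (-m / 2)`. This leaves the words whose indices are
constant exactly on the blocks of a pair partition.

The weight of such a word is a product over pairs of blocks, each factor depending on the single
coefficient `y = μ(i,j)` of the two indices: it is `t y` for a crossing, `t y ^ 2` or `t` for a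
nesting, and `1` otherwise. By independence the weight has mean `q ^ cr * t ^ ne`, and it remains to
prove a strong law for its averages over all tuples of distinct indices. Weights of tuples sharing
at most one index are independent, so for truncated weights the variance of the average is
`O(N ^ (-2))`, which is summable. The truncation error is controlled uniformly in `N` by a maximal
inequality: the weights are dominated by a jointly exchangeable family, whose averages form a
reverse martingale.
-/

open scoped ENNReal

namespace NCCLT

section Exchangeable

variable {ι : Type*}

/-- The action of a permutation of the vertices `ℕ` on families indexed by the `ι`-tuples of
distinct vertices. -/
def relabel {E : Type*} (π : Equiv.Perm ℕ) (z : (ι ↪ ℕ) → E) : (ι ↪ ℕ) → E :=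
  fun i => z (i.trans π.toEmbedding)

/-- Joint exchangeability of the law `Q` of a family of random variables indexed by the `ι`-tuples
of distinct vertices: invariance under all relabellings of the vertices. -/
def IsExchangeable {E : Type*} [MeasurableSpace E] (Q : Measure ((ι ↪ ℕ) → E)) : Prop :=
  ∀ π : Equiv.Perm ℕ, MeasurePreserving (relabel π) Q Q

theorem exists_perm_trans_eq [Finite ι] {N : ℕ} {e : ι ↪ ℕ} (he : ∀ a, e a < N) (i : ι ↪ Fin N) :
    ∃ π : Equiv.Perm ℕ, e.trans π.toEmbedding = i.trans Fin.valEmbedding ∧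
      ∀ k, N ≤ k → π k = k := by
  let e' : ι ↪ Fin N := ⟨fun a => ⟨e a, he a⟩, fun a b h => e.injective (by simpa using h)⟩
  obtain ⟨σ, hσ⟩ := Equiv.Perm.exists_extending_pair e' i e'.injective i.injective
  refine ⟨σ.viaEmbedding Fin.valEmbedding, ?_, fun k hk =>
    σ.viaEmbedding_apply_of_notMem _ _ ?_⟩
  · ext a
    exact (σ.viaEmbedding_apply Fin.valEmbedding (e' a)).trans (congrArg Fin.val (hσ a))
  · rintro ⟨l, rfl⟩
    exact l.isLt.not_ge hk

theorem IsExchangeable.lintegral_apply_eq [Finite ι] {Q : Measure ((ι ↪ ℕ) → ℝ≥0∞)}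
    (hQ : IsExchangeable Q) (i j : ι ↪ ℕ) :
    ∫⁻ z, z i ∂Q = ∫⁻ z, z j ∂Q := by
  obtain ⟨π, hπ⟩ := Equiv.Perm.exists_extending_pair i j i.injective j.injective
  have hij : i.trans π.toEmbedding = j := DFunLike.ext _ _ hπ
  rw [← hij]
  exact ((hQ π).lintegral_comp (measurable_pi_apply i)).symm

variable [Fintype ι]

/-- The sum of `z` over the `ι`-tuples of distinct vertices below `N`; dividing by the number
`Fintype.card (ι ↪ Fin N)` of such tuples gives the averages considered below. -/
noncomputable def tupleSum {M : Type*} [AddCommMonoid M] (N : ℕ) (z : (ι ↪ ℕ) → M) : M :=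
  ∑ i : ι ↪ Fin N, z (i.trans Fin.valEmbedding)

theorem tupleSum_relabel {M : Type*} [AddCommMonoid M] {N : ℕ} {π : Equiv.Perm ℕ}
    (hπ : ∀ k, N ≤ k → π k = k) (z : (ι ↪ ℕ) → M) :
    tupleSum N (relabel π z) = tupleSum N z := by
  have hlt (k : ℕ) : π k < N ↔ k < N := by
    rw [← not_iff_not, not_lt, not_lt]
    exact ⟨fun h => by rwa [← π.injective (hπ _ h)], fun h => by rwa [hπ k h]⟩
  let σ : Equiv.Perm (Fin N) := Fin.equivSubtype.symm.permCongr (π.subtypePerm hlt)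
  exact Fintype.sum_equiv (Equiv.embeddingCongr (Equiv.refl ι) σ) _ _ fun i => rfl

/-- The event that the average of `z` over the tuples below `N` exceeds `c`. -/
def exceedance (c : ℝ≥0∞) (N : ℕ) : Set ((ι ↪ ℕ) → ℝ≥0∞) :=
  {z | c * Fintype.card (ι ↪ Fin N) < tupleSum N z}

theorem measurable_tupleSum (N : ℕ) :
    Measurable (tupleSum N : ((ι ↪ ℕ) → ℝ≥0∞) → ℝ≥0∞) :=
  Finset.measurable_sum _ fun _ _ => measurable_pi_apply _

theorem measurableSet_exceedance (c : ℝ≥0∞) (N : ℕ) :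
    MeasurableSet (exceedance c N : Set ((ι ↪ ℕ) → ℝ≥0∞)) :=
  measurableSet_lt measurable_const (measurable_tupleSum N)

theorem relabel_preimage_exceedance {N N' : ℕ} (hN : N ≤ N') {π : Equiv.Perm ℕ}
    (hπ : ∀ k, N ≤ k → π k = k) (c : ℝ≥0∞) :
    relabel π ⁻¹' (exceedance c N' : Set ((ι ↪ ℕ) → ℝ≥0∞)) = exceedance c N' := by
  ext z
  simp only [exceedance, Set.mem_preimage, Set.mem_ofPred_eq,
    tupleSum_relabel fun k hk => hπ k (hN.trans hk)]

namespace IsExchangeable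

variable {Q : Measure ((ι ↪ ℕ) → ℝ≥0∞)}

theorem setLIntegral_tupleSum (hQ : IsExchangeable Q) {N : ℕ} {e : ι ↪ ℕ} (he : ∀ a, e a < N)
    {S : Set ((ι ↪ ℕ) → ℝ≥0∞)} (hS : MeasurableSet S)
    (hinv : ∀ π : Equiv.Perm ℕ, (∀ k, N ≤ k → π k = k) → relabel π ⁻¹' S = S) :
    ∫⁻ z in S, tupleSum N z ∂Q = Fintype.card (ι ↪ Fin N) * ∫⁻ z in S, z e ∂Q := by
  have hsymm (i : ι ↪ Fin N) :
      ∫⁻ z in S, z (i.trans Fin.valEmbedding) ∂Q = ∫⁻ z in S, z e ∂Q := by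
    obtain ⟨π, hπ, hfix⟩ := exists_perm_trans_eq he i
    rw [← hπ, ← (hQ π).setLIntegral_comp_preimage hS (measurable_pi_apply e), hinv π hfix]
    rfl
  unfold tupleSum
  rw [lintegral_finsetSum _ fun i _ => measurable_pi_apply (i.trans Fin.valEmbedding)]
  simp only [hsymm, Finset.sum_const, Finset.card_univ, nsmul_eq_mul]

/-- The event in question is that `N = M - k` is the last time up to `M` at which the average
exceeds `c`. It is symmetric in the vertices below `N`, because all the averages that it involves
are over tuples below some `N' ≥ N`. -/
theorem mul_measure_disjointed_exceedance_le (hQ : IsExchangeable Q) (c : ℝ≥0∞) {e : ι ↪ ℕ}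
    (he : ∀ a, e a < Fintype.card ι) (M k : ℕ) :
    c * Q (disjointed (fun k => exceedance c (M - k)) k) ≤
      ∫⁻ z in disjointed (fun k => exceedance c (M - k)) k, z e ∂Q := by
  set S := disjointed (fun k => (exceedance c (M - k) : Set ((ι ↪ ℕ) → ℝ≥0∞))) k with hS
  have hsub : S ⊆ exceedance c (M - k) := disjointed_subset _ k
  have hSm : MeasurableSet S :=
    MeasurableSet.disjointed (fun _ => measurableSet_exceedance c _) k
  rcases isEmpty_or_nonempty (ι ↪ Fin (M - k)) with hempty | ⟨⟨i⟩⟩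
  · have : S = ∅ := Set.eq_empty_of_subset_empty fun z hz => by
      simpa [exceedance, tupleSum] using hsub hz
    simp [this]
  have heN (a : ι) : e a < M - k :=
    (he a).trans_le (by simpa using Fintype.card_le_of_embedding i)
  have hinv (π : Equiv.Perm ℕ) (hπ : ∀ l, M - k ≤ l → π l = l) : relabel π ⁻¹' S = S := by
    rw [hS, disjointed_eq_inter_compl]
    simp only [Set.preimage_inter, Set.preimage_iInter, Set.preimage_compl]
    rw [relabel_preimage_exceedance le_rfl hπ]
    refine congrArg _ (Set.iInter₂_congr fun j hj => ?_)
    rw [relabel_preimage_exceedance (Nat.sub_le_sub_left hj.le M) hπ]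
  have hcard : (Fintype.card (ι ↪ Fin (M - k)) : ℝ≥0∞) ≠ 0 :=
    Nat.cast_ne_zero.2 (Fintype.card_pos_iff.2 ⟨i⟩).ne'
  refine (ENNReal.mul_le_mul_iff_right hcard (ENNReal.natCast_ne_top _)).1 ?_
  rw [← hQ.setLIntegral_tupleSum heN hSm hinv, ← mul_assoc, mul_comm _ c, ← setLIntegral_const]
  exact setLIntegral_mono (measurable_tupleSum _) fun z hz => (hsub hz).le

/-- The maximal inequality for exchangeable families; the averages over the tuples below `N` form
a reverse martingale, and the proof is that of Doob's inequality. -/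
theorem mul_measure_iUnion_exceedance_le (hQ : IsExchangeable Q) (c : ℝ≥0∞) (i : ι ↪ ℕ) :
    c * Q (⋃ N, exceedance c N) ≤ ∫⁻ z, z i ∂Q := by
  let e : ι ↪ ℕ := (Fintype.equivFin ι).toEmbedding.trans Fin.valEmbedding
  rw [hQ.lintegral_apply_eq i e, measure_iUnion_eq_iSup_accumulate, ENNReal.mul_iSup]
  refine iSup_le fun M => ?_
  let S := disjointed fun k => (exceedance c (M - k) : Set ((ι ↪ ℕ) → ℝ≥0∞))
  have hSm : ∀ k, MeasurableSet (S k) :=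
    MeasurableSet.disjointed fun _ => measurableSet_exceedance c _
  have hSd : Pairwise (Function.onFun Disjoint S) := disjoint_disjointed _
  have hcover : Set.accumulate (exceedance c) M ⊆ ⋃ k, S k := by
    rw [iUnion_disjointed]
    refine Set.iUnion₂_subset fun N hN => Set.subset_iUnion_of_subset (M - N) ?_
    rw [Nat.sub_sub_self hN]
  calc c * Q (Set.accumulate (exceedance c) M)
      ≤ c * ∑' k, Q (S k) := by rw [← measure_iUnion hSd hSm]; gcongr
    _ = ∑' k, c * Q (S k) := ENNReal.tsum_mul_left.symm
    _ ≤ ∑' k, ∫⁻ z in S k, z e ∂Q := ENNReal.tsum_le_tsum fun k =>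
        hQ.mul_measure_disjointed_exceedance_le c (fun a => (Fintype.equivFin ι a).isLt) M k
    _ = ∫⁻ z in ⋃ k, S k, z e ∂Q := (lintegral_iUnion hSm hSd _).symm
    _ ≤ ∫⁻ z, z e ∂Q := setLIntegral_le_lintegral _ _

end IsExchangeable

end Exchangeable

section Dissociated

theorem card_filter_agree_mul_sq_le {ι α : Type*} [Fintype ι] [DecidableEq ι] [Fintype α]
    [DecidableEq α] (a b : ι) {a' b' : ι} (h : a' ≠ b') :
    (Finset.univ.filter fun x : (ι → α) × (ι → α) =>
      x.1 a = x.2 a' ∧ x.1 b = x.2 b').card * Fintype.card α ^ 2 ≤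
        Fintype.card α ^ (2 * Fintype.card ι) := by
  let B := Finset.univ.filter fun x : (ι → α) × (ι → α) => x.1 a = x.2 a' ∧ x.1 b = x.2 b'
  let F : B × (α × α) → (ι → α) × (ι → α) := fun x =>
    (x.1.1.1, Function.update (Function.update x.1.1.2 a' x.2.1) b' x.2.2)
  have hF : Function.Injective F := by
    rintro ⟨⟨⟨i, i'⟩, hi⟩, x, y⟩ ⟨⟨⟨j, j'⟩, hj⟩, x', y'⟩ hxy
    simp only [B, Finset.mem_filter, Finset.mem_univ, true_and] at hi hj
    simp only [F, Prod.mk.injEq] at hxy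
    obtain ⟨rfl, h2⟩ := hxy
    have hy : y = y' := by simpa using congrFun h2 b'
    have hx : x = x' := by simpa [h] using congrFun h2 a'
    have hij : i' = j' := by
      funext c
      by_cases hcb : c = b'
      · rw [hcb, ← hi.2, ← hj.2]
      by_cases hca : c = a'
      · rw [hca, ← hi.1, ← hj.1]
      simpa [hcb, hca] using congrFun h2 c
    subst hx hy hij
    rfl
  have hcard := Fintype.card_le_of_injective F hF
  simpa only [Fintype.card_prod, Fintype.card_coe, Fintype.card_fun, ← sq, ← pow_mul,
    mul_comm _ 2] using hcard

variable {ι : Type*} [Fintype ι]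

open Classical in
theorem card_filter_nontrivial_range_inter_mul_sq_le (N : ℕ) :
    (Finset.univ.filter fun x : (ι ↪ Fin N) × (ι ↪ Fin N) =>
      (Set.range x.1 ∩ Set.range x.2).Nontrivial).card * N ^ 2 ≤
        Fintype.card ι ^ 4 * N ^ (2 * Fintype.card ι) := by
  let T : Finset ((ι × ι) × (ι × ι)) := Finset.univ.filter fun x => x.2.1 ≠ x.2.2
  let B (x : (ι × ι) × (ι × ι)) := Finset.univ.filter fun y : (ι → Fin N) × (ι → Fin N) =>
    y.1 x.1.1 = y.2 x.2.1 ∧ y.1 x.1.2 = y.2 x.2.2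
  have hT : T.card ≤ Fintype.card ι ^ 4 := by
    refine (Finset.card_le_univ T).trans_eq ?_
    simp only [Fintype.card_prod]
    ring
  have hB : ∀ x ∈ T, (B x).card * N ^ 2 ≤ N ^ (2 * Fintype.card ι) := fun x hx => by
    simpa only [Fintype.card_fin] using
      card_filter_agree_mul_sq_le (α := Fin N) x.1.1 x.1.2 (Finset.mem_filter.1 hx).2
  have hcover : (Finset.univ.filter fun x : (ι ↪ Fin N) × (ι ↪ Fin N) =>
      (Set.range x.1 ∩ Set.range x.2).Nontrivial).card ≤ (T.biUnion B).card := by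
    refine Finset.card_le_card_of_injOn (fun x => (⇑x.1, ⇑x.2)) ?_ ?_
    · rintro ⟨i, i'⟩ hx
      obtain ⟨u, ⟨⟨a, rfl⟩, a', ha⟩, v, ⟨⟨b, rfl⟩, b', hb⟩, huv⟩ := (Finset.mem_filter.1 hx).2
      simp only [Finset.coe_biUnion, Set.mem_iUnion]
      refine ⟨((a, b), (a', b')), Finset.mem_filter.2 ⟨Finset.mem_univ _, fun hab => huv ?_⟩,
        Finset.mem_filter.2 ⟨Finset.mem_univ _, ha.symm, hb.symm⟩⟩
      rw [← ha, ← hb]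
      exact congrArg i' hab
    · exact (DFunLike.coe_injective.prodMap DFunLike.coe_injective).injOn
  calc _ ≤ (∑ x ∈ T, (B x).card) * N ^ 2 :=
        Nat.mul_le_mul_right _ (hcover.trans Finset.card_biUnion_le)
    _ = ∑ x ∈ T, (B x).card * N ^ 2 := Finset.sum_mul _ _ _
    _ ≤ T.card * N ^ (2 * Fintype.card ι) := Finset.sum_le_card_nsmul _ _ _ hB
    _ ≤ _ := Nat.mul_le_mul_right _ hT

variable {Ω : Type*} [MeasurableSpace Ω] {P : Measure Ω}

theorem ae_tendsto_sub_integral_of_summable_variance [IsFiniteMeasure P] {X : ℕ → Ω → ℝ}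
    (hX : ∀ N, MemLp (X N) 2 P) (hsum : Summable fun N => Var[X N; P]) :
    ∀ᵐ ω ∂P, Tendsto (fun N => X N ω - P[X N]) atTop (𝓝 0) := by
  have hm (N : ℕ) : AEMeasurable (fun ω => ‖X N ω - P[X N]‖ₑ ^ 2) P :=
    ((hX N).aemeasurable.sub_const _).enorm.pow_const 2
  have hfin : ∫⁻ ω, ∑' N, ‖X N ω - P[X N]‖ₑ ^ 2 ∂P ≠ ∞ := by
    rw [lintegral_tsum hm]
    simpa only [ofReal_variance (hX _), evariance] using hsum.tsum_ofReal_ne_top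
  filter_upwards [ae_lt_top' (.tsum hm) hfin] with ω hω
  have hsq : Tendsto (fun N => ‖X N ω - P[X N]‖ₑ ^ 2) atTop (𝓝 0) :=
    ENNReal.tendsto_atTop_zero_of_tsum_ne_top hω.ne
  have hroot := hsq.ennrpow_const ((2 : ℕ) : ℝ)⁻¹
  simp only [ENNReal.pow_rpow_inv_natCast two_ne_zero] at hroot
  rw [ENNReal.zero_rpow_of_pos (by positivity)] at hroot
  exact tendsto_zero_iff_enorm_tendsto_zero.2 hroot

theorem covariance_le_of_variance_le [IsFiniteMeasure P] {X Y : Ω → ℝ} (hX : MemLp X 2 P)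
    (hY : MemLp Y 2 P) {C : ℝ} (hXC : Var[X; P] ≤ C) (hYC : Var[Y; P] ≤ C) :
    cov[X, Y; P] ≤ C := by
  have h := variance_nonneg (X - Y) P
  rw [variance_sub hX hY] at h
  linarith

variable [IsFiniteMeasure P] {Y : (ι ↪ ℕ) → Ω → ℝ} (hY : ∀ i, MemLp (Y i) 2 P) {C : ℝ}
  (hC : ∀ i, Var[Y i; P] ≤ C)
  (huncorr : ∀ i j : ι ↪ ℕ, (Set.range i ∩ Set.range j).Subsingleton → cov[Y i, Y j; P] = 0)
include hY hC huncorr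

theorem variance_tupleSum_mul_sq_le (N : ℕ) :
    Var[fun ω => tupleSum N (Y · ω); P] * N ^ 2 ≤
      C * Fintype.card ι ^ 4 * N ^ (2 * Fintype.card ι) := by
  classical
  have hcov (i j : ι ↪ Fin N) :
      cov[Y (i.trans Fin.valEmbedding), Y (j.trans Fin.valEmbedding); P] ≤
        if (Set.range i ∩ Set.range j).Nontrivial then C else 0 := by
    split_ifs with h
    · exact covariance_le_of_variance_le (hY _) (hY _) (hC _) (hC _)
    · refine (huncorr _ _ ?_).le
      rw [Set.not_nontrivial_iff] at h
      simpa only [Function.Embedding.coe_trans, Set.range_comp,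
        ← Set.image_inter Fin.valEmbedding.injective] using h.image _
  have hvar : Var[fun ω => tupleSum N (Y · ω); P] ≤
      (Finset.univ.filter fun x : (ι ↪ Fin N) × (ι ↪ Fin N) =>
        (Set.range x.1 ∩ Set.range x.2).Nontrivial).card * C := by
    unfold tupleSum
    rw [variance_fun_sum fun i => hY _, ← Fintype.sum_prod_type', ← nsmul_eq_mul,
      ← Finset.sum_const, Finset.sum_filter]
    exact Finset.sum_le_sum fun x _ => hcov x.1 x.2
  have hC0 : 0 ≤ C := by
    obtain ⟨i⟩ := nonempty_embedding_nat ι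
    exact (variance_nonneg _ _).trans (hC i)
  have hcount : ((Finset.univ.filter fun x : (ι ↪ Fin N) × (ι ↪ Fin N) =>
      (Set.range x.1 ∩ Set.range x.2).Nontrivial).card : ℝ) * N ^ 2 ≤
        Fintype.card ι ^ 4 * N ^ (2 * Fintype.card ι) := by
    exact_mod_cast card_filter_nontrivial_range_inter_mul_sq_le (ι := ι) N
  calc _ ≤ _ := mul_le_mul_of_nonneg_right hvar (by positivity)
    _ = C * (_ * N ^ 2) := by ring
    _ ≤ C * (Fintype.card ι ^ 4 * N ^ (2 * Fintype.card ι)) := by gcongr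
    _ = _ := by ring

theorem ae_tendsto_tupleSum_sub_integral :
    ∀ᵐ ω ∂P, Tendsto (fun N : ℕ =>
      tupleSum N (fun i => Y i ω - P[Y i]) / (N : ℝ) ^ Fintype.card ι) atTop (𝓝 0) := by
  set n := Fintype.card ι
  let X (N : ℕ) (ω : Ω) : ℝ := ((N : ℝ) ^ n)⁻¹ * tupleSum N (Y · ω)
  have hX (N : ℕ) : MemLp (X N) 2 P := (memLp_finsetSum _ fun i _ => hY _).const_mul _
  have hvar : ∀ᶠ N : ℕ in atTop, ‖Var[X N; P]‖ ≤ C * n ^ 4 * (1 / (N : ℝ) ^ 2) := by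
    filter_upwards [eventually_gt_atTop 0] with N hN
    have h := variance_tupleSum_mul_sq_le hY hC huncorr N
    rw [Real.norm_of_nonneg (variance_nonneg _ _), variance_const_mul, mul_one_div,
      le_div_iff₀ (by positivity), inv_pow, inv_mul_eq_div, div_mul_eq_mul_div,
      div_le_iff₀ (by positivity), ← pow_mul, mul_comm n 2]
    exact h
  have hsum : Summable fun N => Var[X N; P] :=
    .of_norm_bounded_eventually_nat
      ((Real.summable_one_div_nat_pow.2 one_lt_two).mul_left _) hvar
  filter_upwards [ae_tendsto_sub_integral_of_summable_variance hX hsum] with ω hω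
  refine hω.congr fun N => ?_
  have hint (i : ι ↪ ℕ) : Integrable (Y i) P := (hY i).integrable one_le_two
  simp only [X, tupleSum, integral_const_mul]
  rw [integral_finsetSum _ fun i _ => hint _, Finset.sum_sub_distrib, ← mul_sub,
    inv_mul_eq_div]

end Dissociated

section Dominated

variable {ι : Type*}

theorem tendsto_card_embedding_div_pow [Fintype ι] :
    Tendsto (fun N : ℕ => (Fintype.card (ι ↪ Fin N) : ℝ) / (N : ℝ) ^ Fintype.card ι)
      atTop (𝓝 1) := by
  have h := isEquivalent_descFactorial (Fintype.card ι)
  rw [Asymptotics.isEquivalent_iff_tendsto_one] at h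
  · refine h.congr fun N => ?_
    simp [Fintype.card_embedding_eq]
  · filter_upwards [eventually_gt_atTop 0] with N hN
    positivity

theorem IsExchangeable.map {E F : Type*} [MeasurableSpace E] [MeasurableSpace F]
    {Q : Measure ((ι ↪ ℕ) → E)} (hQ : IsExchangeable Q) {g : E → F} (hg : Measurable g) :
    IsExchangeable (Q.map fun z i => g (z i)) := fun π => by
  have hG : Measurable fun (z : (ι ↪ ℕ) → E) i => g (z i) :=
    measurable_pi_lambda _ fun i => hg.comp (measurable_pi_apply i)
  have hrel : Measurable (relabel π : ((ι ↪ ℕ) → F) → (ι ↪ ℕ) → F) :=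
    measurable_pi_lambda _ fun i => measurable_pi_apply _
  refine ⟨hrel, ?_⟩
  rw [Measure.map_map hrel hG]
  conv_rhs => rw [← (hQ π).map_eq, Measure.map_map hG (hQ π).measurable]
  rfl

/-- The part `x 1_{x > K}` of `x` that is removed by truncation at the level `K`. -/
noncomputable def tail (K : ℕ) (x : ℝ≥0∞) : ℝ≥0∞ :=
  (Set.Ioi (K : ℝ≥0∞)).indicator id x

/-- The truncation `y 1_{z ≤ K}` of `y` according to the size of a bound `z` of `y`. -/
noncomputable def truncate (K : ℕ) (z : ℝ≥0∞) (y : ℝ) : ℝ :=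
  if z ≤ K then y else 0

theorem measurable_tail (K : ℕ) : Measurable (tail K) :=
  measurable_id.indicator measurableSet_Ioi

theorem measurable_truncate (K : ℕ) : Measurable fun x : ℝ × ℝ≥0∞ => truncate K x.2 x.1 :=
  Measurable.ite (measurableSet_le measurable_snd measurable_const) measurable_fst
    measurable_const

theorem tail_le_self (K : ℕ) (x : ℝ≥0∞) : tail K x ≤ x :=
  Set.indicator_le_self _ _ _

theorem tail_anti (x : ℝ≥0∞) : Antitone fun K => tail K x := fun _ _ h =>
  Set.indicator_le_indicator_of_subset
    (Set.Ioi_subset_Ioi (Nat.cast_le.2 h)) (fun _ => zero_le) x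

theorem abs_truncate_le {K : ℕ} {z : ℝ≥0∞} {y : ℝ} (h : ‖y‖ₑ ≤ z) : |truncate K z y| ≤ K := by
  unfold truncate
  split_ifs with hz
  · have : ‖y‖ₑ ≤ ((K : NNReal) : ℝ≥0∞) := by simpa using h.trans hz
    exact_mod_cast enorm_le_coe.1 this
  · simp

theorem enorm_sub_truncate_le {K : ℕ} {z : ℝ≥0∞} {y : ℝ} (h : ‖y‖ₑ ≤ z) :
    ‖y - truncate K z y‖ₑ ≤ tail K z := by
  unfold truncate tail
  split_ifs with hz
  · simp
  · simpa [Set.indicator_of_mem (Set.mem_Ioi.2 (not_le.1 hz))] using h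

variable {Ω : Type*} [MeasurableSpace Ω] {P : Measure Ω}

theorem tendsto_lintegral_tail {Z : Ω → ℝ≥0∞} (hZ : Measurable Z) (hfin : ∫⁻ ω, Z ω ∂P ≠ ∞) :
    Tendsto (fun K => ∫⁻ ω, tail K (Z ω) ∂P) atTop (𝓝 0) := by
  rw [← lintegral_zero (μ := P)]
  refine tendsto_lintegral_of_dominated_convergence Z (fun K => (measurable_tail K).comp hZ)
    (fun K => ae_of_all _ fun ω => tail_le_self K _) hfin ?_
  filter_upwards [ae_lt_top hZ hfin] with ω hω
  obtain ⟨K₀, hK₀⟩ := ENNReal.exists_nat_gt hω.ne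
  refine tendsto_const_nhds.congr' ?_
  filter_upwards [eventually_ge_atTop K₀] with K hK
  refine (Set.indicator_of_notMem ?_ _).symm
  exact not_lt.2 (hK₀.le.trans (Nat.cast_le.2 hK))

theorem enorm_centred_sub_centred_le {U V : Ω → ℝ} (hU : Integrable U P) (hV : Integrable V P)
    {W : Ω → ℝ≥0∞} (h : ∀ ω, ‖U ω - V ω‖ₑ ≤ W ω) (ω : Ω) :
    ‖U ω - P[U] - (V ω - P[V])‖ₑ ≤ W ω + ∫⁻ ω', W ω' ∂P := by
  rw [sub_sub_sub_comm, ← integral_sub hU hV]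
  exact enorm_sub_le.trans
    (add_le_add (h ω) ((enorm_integral_le_lintegral_enorm _).trans (lintegral_mono h)))

theorem abs_tupleSum_div_pow_le [Fintype ι] {N : ℕ} {z : (ι ↪ ℕ) → ℝ} {w : (ι ↪ ℕ) → ℝ≥0∞}
    {c : NNReal} (h : ∀ i, ‖z i‖ₑ ≤ w i) (hw : tupleSum N w ≤ c * Fintype.card (ι ↪ Fin N)) :
    |tupleSum N z / (N : ℝ) ^ Fintype.card ι| ≤ c := by
  have hsum : ‖tupleSum N z‖ₑ ≤ ((c * Fintype.card (ι ↪ Fin N) : NNReal) : ℝ≥0∞) := by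
    push_cast
    exact (enorm_sum_le _ _).trans ((Finset.sum_le_sum fun i _ => h _).trans hw)
  have hsum' : |tupleSum N z| ≤ c * Fintype.card (ι ↪ Fin N) := by
    exact_mod_cast enorm_le_coe.1 hsum
  have hcard : (Fintype.card (ι ↪ Fin N) : ℝ) ≤ (N : ℝ) ^ Fintype.card ι := by
    rw [Fintype.card_embedding_eq, Fintype.card_fin]
    exact_mod_cast Nat.descFactorial_le_pow N _
  rw [abs_div, abs_of_nonneg (a := (N : ℝ) ^ Fintype.card ι) (by positivity)]
  exact div_le_of_le_mul₀ (by positivity) c.2 (hsum'.trans (by gcongr))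

variable {Z : (ι ↪ ℕ) → Ω → ℝ≥0∞} (hZ : ∀ i, Measurable (Z i))
  (hexch : IsExchangeable (P.map fun ω i => Z i ω)) (hfin : ∀ i, ∫⁻ ω, Z i ω ∂P ≠ ∞)
include hZ hexch

theorem isExchangeable_map_tail (K : ℕ) :
    IsExchangeable (P.map fun ω i => tail K (Z i ω)) := by
  have hG : Measurable fun (z : (ι ↪ ℕ) → ℝ≥0∞) i => tail K (z i) :=
    measurable_pi_lambda _ fun i => (measurable_tail K).comp (measurable_pi_apply i)
  have h := hexch.map (measurable_tail K)
  rwa [Measure.map_map hG (measurable_pi_lambda _ hZ)] at h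

theorem lintegral_tail_eq [Finite ι] (K : ℕ) (i j : ι ↪ ℕ) :
    ∫⁻ ω, tail K (Z i ω) ∂P = ∫⁻ ω, tail K (Z j ω) ∂P := by
  have hT : Measurable fun ω i => tail K (Z i ω) :=
    measurable_pi_lambda _ fun i => (measurable_tail K).comp (hZ i)
  have h := (isExchangeable_map_tail hZ hexch K).lintegral_apply_eq i j
  rwa [lintegral_map (measurable_pi_apply i) hT, lintegral_map (measurable_pi_apply j) hT] at h

variable [Fintype ι]
include hfin

theorem ae_eventually_forall_tupleSum_tail_le {c : ℝ≥0∞} (hc : c ≠ 0) :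
    ∀ᵐ ω ∂P, ∀ᶠ K in atTop, ∀ N,
      tupleSum N (fun i => tail K (Z i ω)) ≤ c * Fintype.card (ι ↪ Fin N) := by
  obtain ⟨i⟩ := nonempty_embedding_nat ι
  let B (K : ℕ) : Set Ω := (fun ω j => tail K (Z j ω)) ⁻¹' ⋃ N, exceedance c N
  have hB (K : ℕ) : c * P (B K) ≤ ∫⁻ ω, tail K (Z i ω) ∂P := by
    have hT : Measurable fun ω j => tail K (Z j ω) :=
      measurable_pi_lambda _ fun j => (measurable_tail K).comp (hZ j)
    have h := (isExchangeable_map_tail hZ hexch K).mul_measure_iUnion_exceedance_le c i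
    rwa [lintegral_map (measurable_pi_apply i) hT,
      Measure.map_apply hT (.iUnion (measurableSet_exceedance c))] at h
  have hnull : P (⋂ K, B K) = 0 := by
    have hle : c * P (⋂ K, B K) ≤ 0 :=
      ge_of_tendsto' (tendsto_lintegral_tail (hZ i) (hfin i)) fun K => (hB K).trans' <| by
        gcongr
        exact Set.iInter_subset B K
    exact (mul_eq_zero.1 (nonpos_iff_eq_zero.1 hle)).resolve_left hc
  filter_upwards [measure_eq_zero_iff_ae_notMem.1 hnull] with ω hω
  obtain ⟨K₀, hK₀⟩ : ∃ K, ω ∉ B K := by simpa using hω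
  filter_upwards [eventually_ge_atTop K₀] with K hK N
  simp only [B, exceedance, Set.mem_preimage, Set.mem_iUnion, Set.mem_ofPred_eq, not_exists,
    not_lt] at hK₀
  exact (Finset.sum_le_sum fun j _ => tail_anti _ hK).trans (hK₀ N)

variable [IsProbabilityMeasure P] {Y : (ι ↪ ℕ) → Ω → ℝ} (hY : ∀ i, Measurable (Y i))
  (hYZ : ∀ i ω, ‖Y i ω‖ₑ ≤ Z i ω)
include hY hYZ

/-- The truncation error of the centred averages is uniformly small: by the maximal inequality,
the averages of the tails of the bounds `Z` are. -/
theorem ae_tendstoUniformly_truncate :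
    ∀ᵐ ω ∂P, TendstoUniformly
      (fun K N => tupleSum N (fun i =>
        truncate K (Z i ω) (Y i ω) - ∫ ω', truncate K (Z i ω') (Y i ω') ∂P) /
          (N : ℝ) ^ Fintype.card ι)
      (fun N => tupleSum N (fun i => Y i ω - P[Y i]) / (N : ℝ) ^ Fintype.card ι) atTop := by
  obtain ⟨i₀⟩ := nonempty_embedding_nat ι
  have hδ := tendsto_lintegral_tail (hZ i₀) (hfin i₀)
  have hc (k : ℕ) : ((1 / (k + 1) : NNReal) : ℝ≥0∞) ≠ 0 := ENNReal.coe_ne_zero.2 (by positivity)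
  have hT (K : ℕ) (i : ι ↪ ℕ) : Integrable (fun ω => truncate K (Z i ω) (Y i ω)) P :=
    .of_bound ((measurable_truncate K).comp ((hY i).prodMk (hZ i))).aestronglyMeasurable K
      (ae_of_all _ fun ω => abs_truncate_le (hYZ i ω))
  have hYint (i : ι ↪ ℕ) : Integrable (Y i) P :=
    ⟨(hY i).aestronglyMeasurable, (lintegral_mono (hYZ i)).trans_lt (hfin i).lt_top⟩
  filter_upwards [ae_all_iff.2 fun k => ae_eventually_forall_tupleSum_tail_le hZ hexch hfin (hc k)]
    with ω hω
  rw [Metric.tendstoUniformly_iff]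
  intro ε hε
  obtain ⟨k, hk⟩ := exists_nat_one_div_lt (half_pos hε)
  filter_upwards [hω k, hδ.eventually_le_const (pos_iff_ne_zero.2 (hc k))] with K hK hKδ N
  have herr (i : ι ↪ ℕ) := enorm_centred_sub_centred_le (hYint i) (hT K i)
    (fun ω => enorm_sub_truncate_le (hYZ i ω)) ω
  have hsum : tupleSum N (fun i => tail K (Z i ω) + ∫⁻ ω', tail K (Z i ω') ∂P) ≤
      ((1 / (k + 1) + 1 / (k + 1) : NNReal) : ℝ≥0∞) * Fintype.card (ι ↪ Fin N) := by
    simp only [tupleSum, lintegral_tail_eq hZ hexch K _ i₀, Finset.sum_add_distrib,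
      Finset.sum_const, Finset.card_univ, nsmul_eq_mul]
    rw [mul_comm (Fintype.card _ : ℝ≥0∞), ENNReal.coe_add, add_mul]
    gcongr
    exact hK N
  have habs := abs_tupleSum_div_pow_le herr hsum
  rw [Real.dist_eq, ← sub_div]
  simp only [tupleSum, Finset.sum_sub_distrib] at habs ⊢
  refine habs.trans_lt ?_
  push_cast
  linarith

theorem strong_law_ae_tupleSum
    (hindep : ∀ i j : ι ↪ ℕ, (Set.range i ∩ Set.range j).Subsingleton →
      IndepFun (fun ω => (Y i ω, Z i ω)) (fun ω => (Y j ω, Z j ω)) P)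
    {m : ℝ} (hm : ∀ i, P[Y i] = m) :
    ∀ᵐ ω ∂P, Tendsto (fun N : ℕ => tupleSum N (Y · ω) / (N : ℝ) ^ Fintype.card ι)
      atTop (𝓝 m) := by
  let T (K : ℕ) (i : ι ↪ ℕ) (ω : Ω) : ℝ := truncate K (Z i ω) (Y i ω)
  have hTm (K : ℕ) (i : ι ↪ ℕ) : Measurable (T K i) :=
    (measurable_truncate K).comp ((hY i).prodMk (hZ i))
  have hTK (K : ℕ) (i : ι ↪ ℕ) (ω : Ω) : |T K i ω| ≤ K := abs_truncate_le (hYZ i ω)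
  have hT2 (K : ℕ) (i : ι ↪ ℕ) : MemLp (T K i) 2 P :=
    .of_bound (hTm K i).aestronglyMeasurable K (ae_of_all _ (hTK K i))
  have hvar (K : ℕ) (i : ι ↪ ℕ) : Var[T K i; P] ≤ (((K : ℝ) - -K) / 2) ^ 2 :=
    variance_le_sq_of_bounded (ae_of_all _ fun ω => abs_le.1 (hTK K i ω)) (hTm K i).aemeasurable
  have hcov (K : ℕ) (i j : ι ↪ ℕ) (hij : (Set.range i ∩ Set.range j).Subsingleton) :
      cov[T K i, T K j; P] = 0 :=
    ((hindep i j hij).comp (measurable_truncate K) (measurable_truncate K)).covariance_eq_zero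
      (hT2 K i) (hT2 K j)
  filter_upwards [ae_tendstoUniformly_truncate hZ hexch hfin hY hYZ,
    ae_all_iff.2 fun K => ae_tendsto_tupleSum_sub_integral (hT2 K) (hvar K) (hcov K)]
    with ω hunif htrunc
  have hcard := (tendsto_card_embedding_div_pow (ι := ι)).const_mul m
  have hcentred : Tendsto (fun N : ℕ =>
      tupleSum N (fun i => Y i ω - P[Y i]) / (N : ℝ) ^ Fintype.card ι) atTop (𝓝 0) :=
    hunif.tendsto_of_eventually_tendsto (.of_forall htrunc) tendsto_const_nhds
  have hsum := hcentred.add hcard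
  rw [zero_add, mul_one] at hsum
  refine hsum.congr fun N => ?_
  simp only [hm, tupleSum, Finset.sum_sub_distrib, Finset.sum_const, Finset.card_univ,
    nsmul_eq_mul]
  ring

end Dominated

section EdgeWeights

variable {ι : Type*}

/-- The embedding of the edges of the complete graph on `α` into those of the complete graph on
`β` that is induced by an embedding of the vertices. -/
def edgeMap {α β : Type*} (i : α ↪ β) :
    (⊤ : SimpleGraph α).edgeSet ↪ (⊤ : SimpleGraph β).edgeSet :=
  (SimpleGraph.Embedding.completeGraph i).mapEdgeSet

theorem edgeMap_trans {α β γ : Type*} (i : α ↪ β) (j : β ↪ γ) (e : (⊤ : SimpleGraph α).edgeSet) :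
    edgeMap (i.trans j) e = edgeMap j (edgeMap i e) :=
  Subtype.ext (Sym2.map_map (g := j) (f := i) e.1).symm

theorem disjoint_range_edgeMap {α β : Type*} {i j : α ↪ β}
    (hij : (Set.range i ∩ Set.range j).Subsingleton) :
    Disjoint (Set.range (edgeMap i)) (Set.range (edgeMap j)) := by
  rw [Set.disjoint_left]
  rintro _ ⟨⟨e, he⟩, rfl⟩ ⟨⟨e', he'⟩, h⟩
  have hmap : Sym2.map j e' = Sym2.map i e := congrArg Subtype.val h
  have hmem (a : α) (ha : a ∈ e) : i a ∈ Set.range i ∩ Set.range j := by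
    have hia : i a ∈ Sym2.map j e' := hmap ▸ Sym2.mem_map.2 ⟨a, ha, rfl⟩
    obtain ⟨b, -, hb⟩ := Sym2.mem_map.1 hia
    exact ⟨⟨a, rfl⟩, b, hb⟩
  induction e with
  | h a b =>
    refine ((SimpleGraph.mem_edgeSet _).1 he).ne (i.injective ?_)
    exact hij (hmem a (Sym2.mem_mk_left a b)) (hmem b (Sym2.mem_mk_right a b))

variable {Ω S : Type*} [MeasurableSpace Ω] [MeasurableSpace S] {P : Measure Ω} {ν : Measure S}
  {X : (⊤ : SimpleGraph ℕ).edgeSet → Ω → S} (hX : ∀ e, Measurable (X e)) (hind : iIndepFun X P)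
include hX hind

theorem isExchangeable_map_edgeMap (hlaw : ∀ e, HasLaw (X e) ν P) :
    IsExchangeable (P.map fun ω (i : ι ↪ ℕ) e => X (edgeMap i e) ω) := fun π => by
  have hW : Measurable fun ω (i : ι ↪ ℕ) e => X (edgeMap i e) ω := by fun_prop
  have hrel : Measurable (relabel π : ((ι ↪ ℕ) → (⊤ : SimpleGraph ι).edgeSet → S) → _) :=
    measurable_pi_lambda _ fun i => measurable_pi_apply _
  have hpull : Measurable fun (x : (⊤ : SimpleGraph ℕ).edgeSet → S) (i : ι ↪ ℕ) e =>
    x (edgeMap i e) := by fun_prop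
  have hmap : P.map (fun ω e => X (edgeMap π.toEmbedding e) ω) = Measure.infinitePi fun _ => ν := by
    rw [(hind.precomp (edgeMap π.toEmbedding).injective).map_fun_eq_infinitePi_map fun e => hX _]
    simp only [(hlaw _).map_eq]
  refine ⟨hrel, ?_⟩
  calc (P.map fun ω (i : ι ↪ ℕ) e => X (edgeMap i e) ω).map (relabel π)
      = (P.map fun ω e => X (edgeMap π.toEmbedding e) ω).map fun x i e => x (edgeMap i e) := by
        rw [Measure.map_map hrel hW, Measure.map_map hpull (by fun_prop)]
        refine congrArg P.map (funext fun ω => funext fun i => funext fun e => ?_)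
        exact congrArg (X · ω) (edgeMap_trans i π.toEmbedding e)
    _ = (P.map fun ω e => X e ω).map fun x i e => x (edgeMap i e) := by
        rw [hmap, hind.map_fun_eq_infinitePi_map hX]
        simp only [(hlaw _).map_eq]
    _ = P.map fun ω (i : ι ↪ ℕ) e => X (edgeMap i e) ω := Measure.map_map hpull (by fun_prop)

theorem indepFun_edgeMap [Finite ι] {i j : ι ↪ ℕ}
    (hij : (Set.range i ∩ Set.range j).Subsingleton) :
    IndepFun (fun ω e => X (edgeMap i e) ω) (fun ω e => X (edgeMap j e) ω) P := by
  have := Fintype.ofFinite (⊤ : SimpleGraph ι).edgeSet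
  have hdisj : Disjoint (Finset.univ.map (edgeMap i)) (Finset.univ.map (edgeMap j)) := by
    rw [← Finset.disjoint_coe]
    simpa using disjoint_range_edgeMap hij
  have hmem (k : ι ↪ ℕ) (e : (⊤ : SimpleGraph ι).edgeSet) :
      edgeMap k e ∈ Finset.univ.map (edgeMap k) :=
    Finset.mem_map_of_mem _ (Finset.mem_univ e)
  have hrestr (k : ι ↪ ℕ) : Measurable fun (x : Finset.univ.map (edgeMap k) → S) e =>
      x ⟨edgeMap k e, hmem k e⟩ := by fun_prop
  exact (hind.indepFun_finset _ _ hdisj hX).comp (hrestr i) (hrestr j)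

theorem strong_law_ae_tupleSum_prod_edges [Fintype ι] (hlaw : ∀ e, HasLaw (X e) ν P)
    {ρ : Type*} [Fintype ρ] {e : ρ → (⊤ : SimpleGraph ι).edgeSet} (he : Function.Injective e)
    {g : (ι ↪ ℕ) → ρ → S → ℝ} (hg : ∀ i r, Measurable (g i r))
    {G : S → ℝ≥0∞} (hG : Measurable G) (hgG : ∀ i r x, ‖g i r x‖ₑ ≤ G x)
    (hGfin : ∫⁻ x, G x ∂ν ≠ ∞) {m : ρ → ℝ} (hm : ∀ i r, ∫ x, g i r x ∂ν = m r) :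
    ∀ᵐ ω ∂P, Tendsto (fun N : ℕ => tupleSum N (fun i => ∏ r, g i r (X (edgeMap i (e r)) ω)) /
      (N : ℝ) ^ Fintype.card ι) atTop (𝓝 (∏ r, m r)) := by
  have := hind.isProbabilityMeasure
  let w (x : (⊤ : SimpleGraph ι).edgeSet → S) : ℝ≥0∞ := ∏ r, G (x (e r))
  let y (i : ι ↪ ℕ) (x : (⊤ : SimpleGraph ι).edgeSet → S) : ℝ := ∏ r, g i r (x (e r))
  have hw : Measurable w := by fun_prop
  have hy (i : ι ↪ ℕ) : Measurable (y i) := by fun_prop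
  have hW (i : ι ↪ ℕ) : Measurable fun ω e => X (edgeMap i e) ω := by fun_prop
  have hXe (i : ι ↪ ℕ) : iIndepFun (fun r => X (edgeMap i (e r))) P :=
    hind.precomp ((edgeMap i).injective.comp he)
  refine strong_law_ae_tupleSum (Z := fun i ω => w fun e => X (edgeMap i e) ω)
    (Y := fun i ω => y i fun e => X (edgeMap i e) ω) (fun i => hw.comp (hW i)) ?_ (fun i => ?_)
    (fun i => (hy i).comp (hW i)) (fun i ω => ?_) (fun i j hij => ?_) (fun i => ?_)
  · have h := (isExchangeable_map_edgeMap (ι := ι) hX hind hlaw).map hw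
    rwa [Measure.map_map (by fun_prop) (measurable_pi_lambda _ hW)] at h
  · have hGX : iIndepFun (fun r ω => G (X (edgeMap i (e r)) ω)) P :=
      (hXe i).comp (fun _ => G) fun _ => hG
    simp only [w]
    rw [lintegral_prod_eq_prod_lintegral_of_indepFun _ _ hGX fun r => hG.comp (hX _)]
    refine ENNReal.prod_ne_top fun r _ => ?_
    rwa [(hlaw _).lintegral_comp hG.aemeasurable]
  · simp only [w, y, enorm_eq_nnnorm, nnnorm_prod, ENNReal.ofNNReal_finsetProd]
    exact Finset.prod_le_prod' fun r _ => hgG i r _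
  · exact (indepFun_edgeMap hX hind hij).comp ((hy i).prodMk hw) ((hy j).prodMk hw)
  · have hgX : iIndepFun (fun r ω => g i r (X (edgeMap i (e r)) ω)) P :=
      (hXe i).comp (fun r => g i r) fun r => hg i r
    rw [hgX.integral_fun_prod_eq_prod_integral fun r =>
      ((hg i r).comp (hX _)).aestronglyMeasurable]
    exact Finset.prod_congr rfl fun r _ =>
      ((hlaw _).integral_comp (hg i r).aestronglyMeasurable).trans (hm i r)

end EdgeWeights

section Words

theorem prod_map_filter_of_eq_one {M α : Type*} [Monoid M] {p : α → Prop} [DecidablePred p]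
    {f : α → M} (hf : ∀ a, ¬ p a → f a = 1) (l : List α) :
    ((l.filter p).map f).prod = (l.map f).prod := by
  induction l with
  | nil => simp
  | cons a l ih =>
    by_cases h : p a
    · simp [h, ih]
    · simp [h, ih, hf a h]

theorem exists_prod_range_update {M : Type*} [Monoid M] (f : ℕ → M) (x : M) {v N : ℕ}
    (h : v < N) :
    ∃ y, ((List.range N).map f).prod = ((List.range v).map f).prod * y ∧
      ((List.range N).map (Function.update f v (x * f v))).prod =
        ((List.range v).map f).prod * (x * y) := by
  induction N, h using Nat.le_induction with
  | base =>
    have hmap : (List.range v).map (Function.update f v (x * f v)) = (List.range v).map f :=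
      List.map_congr_left fun u hu => Function.update_of_ne (List.mem_range.1 hu).ne _ _
    exact ⟨f v, by simp [List.prod_range_succ, hmap]⟩
  | succ N hN ih =>
    obtain ⟨y, hy, hy'⟩ := ih
    have hne : N ≠ v := (Nat.lt_of_succ_le hN).ne'
    exact ⟨y * f N, by simp [List.prod_range_succ, hy, hy', hne, mul_assoc]⟩

theorem finRange_filter_eq {m : ℕ} {l : List (Fin m)} (hl : l.Pairwise (· < ·))
    {p : Fin m → Prop} [DecidablePred p] (hp : ∀ k, p k ↔ k ∈ l) :
    (List.finRange m).filter p = l := by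
  refine List.Perm.eq_of_pairwise (le := (· < ·)) (fun a b _ _ hab hba => absurd hab hba.asymm)
    ((List.pairwise_lt_finRange m).filter _) hl ?_
  rw [List.perm_ext_iff_of_nodup ((List.nodup_finRange m).filter _) (hl.imp ne_of_lt)]
  simp [hp]

variable {A : Type*} [Ring A] [StarRing A] [Algebra ℂ A]

/-- The word `b_{j 0}^{ε 0} ⋯ b_{j (m-1)}^{ε (m-1)}`. -/
def word (b : ℕ → A) {m : ℕ} (j : Fin m → ℕ) (ε : Fin m → Expo) : A :=
  (List.ofFn fun k => epow (b (j k)) (ε k)).prod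

/-- The product of the letters with index `v` in the word with indices `j` and exponents `ε`, in
their order of appearance. -/
def subword (b : ℕ → A) {m : ℕ} (j : Fin m → ℕ) (ε : Fin m → Expo) (v : ℕ) : A :=
  (((List.finRange m).filter fun k => j k = v).map fun k => epow (b v) (ε k)).prod

/-- The scalar produced by commuting the letter at the position `k` past the one at the position
`l` when a word is put into natural order; it is `1` unless the two positions are an inversion
of `j`. -/
def inversionFactor (c : Expo → Expo → ℕ → ℕ → ℝ) {m : ℕ} (j : Fin m → ℕ) (ε : Fin m → Expo)
    (k l : Fin m) : ℝ :=
  if k < l ∧ j l < j k then c (ε l) (ε k) (j l) (j k) else 1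

/-- The scalar produced when a word is put into natural order by commutations with the
coefficients `c`. -/
def wordWeight (c : Expo → Expo → ℕ → ℕ → ℝ) {m : ℕ} (j : Fin m → ℕ) (ε : Fin m → Expo) : ℝ :=
  ∏ k, ∏ l, inversionFactor c j ε k l

theorem wordWeight_succ (c : Expo → Expo → ℕ → ℕ → ℝ) {m : ℕ} (j : Fin (m + 1) → ℕ)
    (ε : Fin (m + 1) → Expo) :
    wordWeight c j ε =
      (∏ l : Fin m, if j l.succ < j 0 then c (ε l.succ) (ε 0) (j l.succ) (j 0) else 1) *
        wordWeight c (fun k => j k.succ) fun k => ε k.succ := by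
  simp [wordWeight, inversionFactor, Fin.prod_univ_succ]

omit [Algebra ℂ A] in
theorem subword_succ (b : ℕ → A) {m : ℕ} (j : Fin (m + 1) → ℕ) (ε : Fin (m + 1) → Expo) :
    subword b j ε = Function.update (subword b (fun k => j k.succ) fun k => ε k.succ) (j 0)
      (epow (b (j 0)) (ε 0) * subword b (fun k => j k.succ) (fun k => ε k.succ) (j 0)) := by
  funext v
  rcases eq_or_ne (j 0) v with rfl | hv
  · simp [subword, List.finRange_succ, List.filter_map, Function.comp_def]
  · simp [subword, List.finRange_succ, List.filter_map, Function.comp_def, hv, hv.symm]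

section Commutation

variable {c : Expo → Expo → ℕ → ℕ → ℝ} {b : ℕ → A} (hc : CommutationRelation c b)
include hc

theorem epow_mul_subword {m : ℕ} (j : Fin m → ℕ) (ε : Fin m → Expo) {i v : ℕ} (h : i ≠ v)
    (e : Expo) :
    epow (b i) e * subword b j ε v =
      ((∏ l, if j l = v then c (ε l) e (j l) i else 1 : ℝ) : ℂ) •
        (subword b j ε v * epow (b i) e) := by
  induction m with
  | zero => simp [subword]
  | succ m ih =>
    rw [subword_succ, Fin.prod_univ_succ]
    rcases eq_or_ne (j 0) v with rfl | hv
    · rw [if_pos rfl, Function.update_self, ← mul_assoc, hc i _ h e (ε 0), smul_mul_assoc,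
        mul_assoc, ih, mul_smul_comm, smul_smul, mul_assoc, Complex.ofReal_mul]
    · rw [if_neg hv, Function.update_of_ne hv.symm, one_mul, ih]

theorem epow_mul_prod_subword {m : ℕ} (j : Fin m → ℕ) (ε : Fin m → Expo) {i M : ℕ} (h : M ≤ i)
    (e : Expo) :
    epow (b i) e * ((List.range M).map (subword b j ε)).prod =
      ((∏ l, if j l < M then c (ε l) e (j l) i else 1 : ℝ) : ℂ) •
        (((List.range M).map (subword b j ε)).prod * epow (b i) e) := by
  induction M with
  | zero => simp
  | succ M ih =>
    have hsplit : (∏ l, if j l < M + 1 then c (ε l) e (j l) i else 1 : ℝ) =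
        (∏ l, if j l < M then c (ε l) e (j l) i else 1) *
          ∏ l, if j l = M then c (ε l) e (j l) i else 1 := by
      rw [← Finset.prod_mul_distrib]
      refine Finset.prod_congr rfl fun l _ => ?_
      rcases lt_trichotomy (j l) M with h' | h' | h'
      · simp [h', h'.ne, Nat.lt_succ_of_lt h']
      · simp [h']
      · simp [h'.not_gt, h'.ne', (Nat.succ_le_of_lt h').not_gt]
    rw [List.prod_range_succ, ← mul_assoc, ih (Nat.le_of_succ_le h), smul_mul_assoc, mul_assoc,
      epow_mul_subword hc j ε (Nat.lt_of_succ_le h).ne' e, mul_smul_comm, smul_smul, mul_assoc,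
      hsplit, Complex.ofReal_mul]

theorem word_eq_smul_prod_subword {m : ℕ} (j : Fin m → ℕ) (ε : Fin m → Expo) {N : ℕ}
    (hj : ∀ k, j k < N) :
    word b j ε = (wordWeight c j ε : ℂ) • ((List.range N).map (subword b j ε)).prod := by
  induction m with
  | zero => simp [word, wordWeight, show subword b j ε = fun _ => 1 from rfl]
  | succ m ih =>
    obtain ⟨y, hy, hy'⟩ := exists_prod_range_update
      (subword b (fun k => j k.succ) fun k => ε k.succ) (epow (b (j 0)) (ε 0)) (hj 0)
    have hword : word b j ε =
        epow (b (j 0)) (ε 0) * word b (fun k => j k.succ) (fun k => ε k.succ) := by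
      simp [word, List.ofFn_succ]
    rw [hword, ih _ _ fun k => hj k.succ, mul_smul_comm, hy, ← mul_assoc,
      epow_mul_prod_subword hc _ _ le_rfl, subword_succ, hy', wordWeight_succ, smul_mul_assoc,
      smul_smul, mul_assoc, Complex.ofReal_mul, mul_comm (Complex.ofReal _)]

end Commutation

variable {φ : A →ₗ[ℂ] ℂ} {b : ℕ → A}

theorem FactorsOverNaturallyOrdered.map_one (hf : FactorsOverNaturallyOrdered φ b) : φ 1 = 1 := by
  simpa using hf []

theorem FactorsOverNaturallyOrdered.map_prod_subword (hf : FactorsOverNaturallyOrdered φ b) {m : ℕ}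
    (j : Fin m → ℕ) (ε : Fin m → Expo) (N : ℕ) :
    φ ((List.range N).map (subword b j ε)).prod =
      ∏ v ∈ Finset.range N, φ (subword b j ε v) := by
  let value (B : ℕ × List Expo) : A := (B.2.map (epow (b B.1))).prod
  let block (v : ℕ) : ℕ × List Expo := (v, ((List.finRange m).filter fun k => j k = v).map ε)
  have hblock (v : ℕ) : value (block v) = subword b j ε v := by
    simp [value, block, subword, Function.comp_def]
  let L := ((List.range N).map block).filter fun B => B.2 ≠ []
  have hL : (L.map Prod.fst).Pairwise (· < ·) := by
    refine List.pairwise_lt_range.sublist (l₂ := List.range N) ?_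
    simpa [L, Function.comp_def, block] using
      (List.filter_sublist (p := fun B => B.2 ≠ []) (l := (List.range N).map block)).map Prod.fst
  have key : φ (L.map value).prod = (L.map fun B => φ (value B)).prod :=
    hf L (fun B hB => by simpa using (List.mem_filter.1 hB).2) hL
  rw [prod_map_filter_of_eq_one fun B hB => by simp [value, not_not.1 hB],
    prod_map_filter_of_eq_one fun B hB => by simp [value, not_not.1 hB, hf.map_one]] at key
  simp only [List.map_map, Function.comp_def, hblock] at key
  rw [key, ← List.prod_toFinset _ List.nodup_range, List.toFinset_range]

variable {c : Expo → Expo → ℕ → ℕ → ℝ}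

theorem map_word (hf : FactorsOverNaturallyOrdered φ b) (hc : CommutationRelation c b) {m : ℕ}
    (j : Fin m → ℕ) (ε : Fin m → Expo) :
    φ (word b j ε) =
      wordWeight c j ε * ∏ v ∈ Finset.univ.image j, φ (subword b j ε v) := by
  have hlt (k : Fin m) : j k < Finset.univ.sup j + 1 :=
    Nat.lt_succ_of_le (Finset.le_sup (Finset.mem_univ k))
  rw [word_eq_smul_prod_subword hc j ε hlt, map_smul, hf.map_prod_subword, smul_eq_mul]
  congr 1
  refine (Finset.prod_subset (Finset.image_subset_iff.2 fun k _ =>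
    Finset.mem_range.2 (hlt k)) fun v _ hv => ?_).symm
  have hne : ∀ k, j k ≠ v := by simpa using hv
  simp [subword, hne, hf.map_one]

theorem map_word_eq_zero_of_forall_eq (hb : MomentCondition φ b) (hc : CommutationRelation c b)
    {m : ℕ} (j : Fin m → ℕ) (ε : Fin m → Expo) {k₀ : Fin m} (hk₀ : ∀ k, j k = j k₀ → k = k₀) :
    φ (word b j ε) = 0 := by
  have hsub : subword b j ε (j k₀) = epow (b (j k₀)) (ε k₀) := by
    rw [subword, finRange_filter_eq (List.pairwise_singleton (· < ·) k₀)]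
    · simp
    · exact fun k => ⟨fun h => List.mem_singleton.2 (hk₀ k h), fun h => by simp_all⟩
  have hzero : φ (epow (b (j k₀)) (ε k₀)) = 0 := by
    cases ε k₀
    · exact hb.centred _
    · exact hb.centred_star _
  rw [map_word hb.factors hc, Finset.prod_eq_zero (Finset.mem_image_of_mem j (Finset.mem_univ k₀)),
    mul_zero]
  rw [hsub, hzero]

end Words

section PairPartitions

theorem card_fiber_eq_of_card_le_mul_card_image {ι α : Type*} [Fintype ι] [DecidableEq α]
    {f : ι → α} {n : ℕ} (hf : ∀ k, n ≤ (Finset.univ.filter fun l => f l = f k).card)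
    (hn : Fintype.card ι ≤ n * (Finset.univ.image f).card) (k : ι) :
    (Finset.univ.filter fun l => f l = f k).card = n := by
  have hle : ∀ v ∈ Finset.univ.image f, n ≤ (Finset.univ.filter fun l => f l = v).card := by
    simpa using hf
  have hsum : ∑ _v ∈ Finset.univ.image f, n =
      ∑ v ∈ Finset.univ.image f, (Finset.univ.filter fun l => f l = v).card := by
    refine le_antisymm (Finset.sum_le_sum hle) ?_
    rwa [← Finset.card_eq_sum_card_image, Finset.card_univ, Finset.sum_const, smul_eq_mul,
      mul_comm]
  exact ((Finset.sum_eq_sum_iff_of_le hle).1 hsum _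
    (Finset.mem_image_of_mem f (Finset.mem_univ k))).symm

theorem card_filter_card_image_le {ι α : Type*} [Fintype ι] [DecidableEq ι] [Nonempty ι]
    [Fintype α] [DecidableEq α] (r : ℕ) :
    (Finset.univ.filter fun j : ι → α => (Finset.univ.image j).card ≤ r).card ≤
      r ^ Fintype.card ι * Fintype.card α ^ r := by
  have hsub : (Finset.univ.filter fun j : ι → α => (Finset.univ.image j).card ≤ r) ⊆
      Finset.univ.image fun x : (ι → Fin r) × (Fin r → α) => x.2 ∘ x.1 := by
    intro j hj
    have hr := (Finset.mem_filter.1 hj).2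
    let e := (Finset.univ.image j).equivFin
    refine Finset.mem_image.2 ⟨(fun k => Fin.castLE hr (e ⟨j k, by simp⟩),
      fun x => if h : x < (Finset.univ.image j).card then e.symm ⟨x, h⟩
        else j (Classical.arbitrary ι)), Finset.mem_univ _, ?_⟩
    funext k
    simp
  refine (Finset.card_le_card hsub).trans (Finset.card_image_le.trans (le_of_eq ?_))
  simp

variable {m : ℕ} {V : Finset (Fin m × Fin m)}

theorem fst_lt_snd_of_mem (hV : V ∈ pairPartitions m) {p : Fin m × Fin m} (hp : p ∈ V) :
    p.1 < p.2 :=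
  (Finset.mem_filter.1 hV).2.1 p hp

theorem exists_unique_block (hV : V ∈ pairPartitions m) (k : Fin m) :
    ∃ p : V, ∀ q : V, (k = q.1.1 ∨ k = q.1.2) ↔ p = q := by
  obtain ⟨p, hp⟩ := Finset.card_eq_one.1 ((Finset.mem_filter.1 hV).2.2 k)
  have hmem (q : Fin m × Fin m) : q ∈ V ∧ (q.1 = k ∨ q.2 = k) ↔ q = p := by
    simpa using Finset.ext_iff.1 hp q
  refine ⟨⟨p, ((hmem p).2 rfl).1⟩, fun q => ?_⟩
  rw [eq_comm (a := k), eq_comm (a := k), Subtype.ext_iff, eq_comm (a := p), ← hmem]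
  simp

/-- The block of a pair partition that contains `k`. -/
noncomputable def blockOf (hV : V ∈ pairPartitions m) (k : Fin m) : V :=
  (exists_unique_block hV k).choose

theorem blockOf_eq_iff (hV : V ∈ pairPartitions m) (k : Fin m) (p : V) :
    blockOf hV k = p ↔ k = p.1.1 ∨ k = p.1.2 :=
  ((exists_unique_block hV k).choose_spec p).symm

theorem blockOf_fst (hV : V ∈ pairPartitions m) (p : V) : blockOf hV p.1.1 = p :=
  (blockOf_eq_iff hV _ _).2 (Or.inl rfl)

theorem blockOf_snd (hV : V ∈ pairPartitions m) (p : V) : blockOf hV p.1.2 = p :=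
  (blockOf_eq_iff hV _ _).2 (Or.inr rfl)

theorem blockOf_surjective (hV : V ∈ pairPartitions m) : Function.Surjective (blockOf hV) :=
  fun p => ⟨p.1.1, blockOf_fst hV p⟩

theorem block_eq_of_fst_eq (hV : V ∈ pairPartitions m) {p q : V} (h : p.1.1 = q.1.1) : p = q := by
  rw [← blockOf_fst hV p, h, blockOf_fst]

theorem block_eq_of_snd_eq (hV : V ∈ pairPartitions m) {p q : V} (h : p.1.2 = q.1.2) : p = q := by
  rw [← blockOf_snd hV p, h, blockOf_snd]

theorem fst_ne_snd_of_mem (hV : V ∈ pairPartitions m) (p q : V) : p.1.1 ≠ q.1.2 := by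
  intro h
  obtain rfl : p = q := by rw [← blockOf_fst hV p, h, blockOf_snd]
  exact (fst_lt_snd_of_mem hV p.2).ne h

@[to_additive]
theorem prod_eq_prod_blocks {M : Type*} [CommMonoid M] (hV : V ∈ pairPartitions m)
    (f : Fin m → M) : ∏ k, f k = ∏ p : V, f p.1.1 * f p.1.2 := by
  rw [← Finset.prod_fiberwise (g := blockOf hV)]
  refine Finset.prod_congr rfl fun p _ => ?_
  have hfiber : (Finset.univ.filter fun k => blockOf hV k = p) = {p.1.1, p.1.2} := by
    ext k
    simp [blockOf_eq_iff]
  rw [hfiber, Finset.prod_pair (fst_lt_snd_of_mem hV p.2).ne]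

theorem two_mul_card_of_mem_pairPartitions (hV : V ∈ pairPartitions m) : 2 * V.card = m := by
  simpa [mul_comm] using (sum_eq_sum_blocks (M := ℕ) hV fun _ => 1).symm

theorem pairPartitions_odd (n : ℕ) : pairPartitions (2 * n + 1) = ∅ := by
  refine Finset.eq_empty_of_forall_notMem fun V hV => ?_
  have := two_mul_card_of_mem_pairPartitions hV
  omega

/-- The pairs of blocks listed in the order of their first elements. -/
def orderedBlockPairs (V : Finset (Fin m × Fin m)) : Finset (V × V) :=
  Finset.univ.filter fun r => r.1.1.1 < r.2.1.1

theorem fst_lt_fst_of_mem_orderedBlockPairs {r : V × V} (hr : r ∈ orderedBlockPairs V) :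
    r.1.1.1 < r.2.1.1 :=
  (Finset.mem_filter.1 hr).2

theorem prod_block_pairs {M : Type*} [CommMonoid M] (hV : V ∈ pairPartitions m)
    (a : V × V → M) (hdiag : ∀ p, a (p, p) = 1) :
    ∏ r, a r = ∏ r ∈ orderedBlockPairs V, a r * a r.swap := by
  have hsplit (r : V × V) : a r =
      (if r.1.1.1 < r.2.1.1 then a r else 1) * if r.2.1.1 < r.1.1.1 then a r else 1 := by
    rcases lt_trichotomy r.1.1.1 r.2.1.1 with h | h | h
    · simp [h, h.not_gt]
    · rw [← Prod.mk.eta (p := r), block_eq_of_fst_eq hV h, hdiag]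
      simp
    · simp [h, h.not_gt]
  have hswap : (∏ r : V × V, if r.2.1.1 < r.1.1.1 then a r else 1) =
      ∏ r : V × V, if r.1.1.1 < r.2.1.1 then a r.swap else 1 :=
    Fintype.prod_equiv (Equiv.prodComm V V) _ _ fun _ => rfl
  rw [Finset.prod_congr rfl fun r _ => hsplit r, Finset.prod_mul_distrib, hswap,
    Finset.prod_mul_distrib, orderedBlockPairs, Finset.prod_filter, Finset.prod_filter]

/-- The two blocks cross, the first one opening first. -/
def Crosses (r : V × V) : Prop :=
  r.1.1.1 < r.2.1.1 ∧ r.2.1.1 < r.1.1.2 ∧ r.1.1.2 < r.2.1.2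

/-- The second block is nested in the first one. -/
def Nests (r : V × V) : Prop :=
  r.1.1.1 < r.2.1.1 ∧ r.2.1.1 < r.2.1.2 ∧ r.2.1.2 < r.1.1.2

instance : DecidablePred (Crosses (V := V)) := fun _ => inferInstanceAs (Decidable (_ ∧ _))

instance : DecidablePred (Nests (V := V)) := fun _ => inferInstanceAs (Decidable (_ ∧ _))

theorem Crosses.not_nests {r : V × V} (h : Crosses r) : ¬ Nests r := fun h' =>
  (h.2.2.trans h'.2.2).false

theorem card_filter_product_self {α : Type*} (s : Finset α) (p : α × α → Prop)
    [DecidablePred p] :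
    ((s ×ˢ s).filter p).card = (Finset.univ.filter fun r : s × s => p (r.1.1, r.2.1)).card := by
  refine (Finset.card_bij (fun r _ => (r.1.1, r.2.1)) ?_ ?_ ?_).symm
  · rintro ⟨a, b⟩ h
    simpa using h
  · rintro ⟨a, b⟩ - ⟨a', b'⟩ - h
    simpa only [Prod.mk.injEq, Subtype.val_inj] using h
  · rintro ⟨a, b⟩ h
    simp only [Finset.mem_filter, Finset.mem_product] at h
    exact ⟨(⟨a, h.1.1⟩, ⟨b, h.1.2⟩), by simpa using h.2, rfl⟩

theorem prod_orderedBlockPairs_eq {M : Type*} [CommMonoid M] (V : Finset (Fin m × Fin m))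
    (q t : M) :
    ∏ r ∈ orderedBlockPairs V, (if Crosses r then q else if Nests r then t else 1) =
      q ^ crossings V * t ^ nestings V := by
  have hcr : crossings V = (Finset.univ.filter fun r : V × V => Crosses r).card :=
    card_filter_product_self V _
  have hne : nestings V = (Finset.univ.filter fun r : V × V => Nests r).card :=
    card_filter_product_self V _
  rw [hcr, hne, ← Finset.prod_const, ← Finset.prod_const, Finset.prod_filter, Finset.prod_filter,
    ← Finset.prod_mul_distrib, orderedBlockPairs, Finset.prod_filter]
  refine Finset.prod_congr rfl fun r _ => ?_
  by_cases hc : Crosses r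
  · simp [hc, hc.not_nests, hc.1]
  · by_cases hn : Nests r
    · simp [hc, hn, hn.1]
    · simp [hc, hn]

variable {α : Type*} [DecidableEq α]

/-- The pairs of positions `k < l` with `j k = j l`. They form a pair partition if and only if every
value of `j` is attained exactly twice. -/
def kernelPairs (j : Fin m → α) : Finset (Fin m × Fin m) :=
  Finset.univ.filter fun p => p.1 < p.2 ∧ j p.1 = j p.2

theorem mem_kernelPairs {j : Fin m → α} {k l : Fin m} :
    (k, l) ∈ kernelPairs j ↔ k < l ∧ j k = j l := by
  simp [kernelPairs]

theorem kernelPairs_mem_pairPartitions {j : Fin m → α}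
    (hj : ∀ k, (Finset.univ.filter fun l => j l = j k).card = 2) :
    kernelPairs j ∈ pairPartitions m := by
  refine Finset.mem_filter.2 ⟨Finset.mem_univ _, fun p hp => (Finset.mem_filter.1 hp).2.1,
    fun k => ?_⟩
  obtain ⟨x, y, hxy, hfiber⟩ := Finset.card_eq_two.1 (hj k)
  have hmem (l : Fin m) : j l = j k ↔ l = x ∨ l = y := by
    simpa using Finset.ext_iff.1 hfiber l
  wlog hlt : x < y generalizing x y
  · exact this y x hxy.symm (hfiber.trans (Finset.pair_comm x y))
      (fun l => (hmem l).trans or_comm) (hxy.lt_or_gt.resolve_left hlt)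
  refine Finset.card_eq_one.2 ⟨(x, y), Finset.ext fun ⟨a, b⟩ => ?_⟩
  simp only [Finset.mem_filter, mem_kernelPairs, Finset.mem_singleton, Prod.mk.injEq]
  grind

theorem kernelPairs_comp_blockOf (hV : V ∈ pairPartitions m) (i : V ↪ α) :
    kernelPairs (i ∘ blockOf hV) = V := by
  ext ⟨x, y⟩
  simp only [mem_kernelPairs, Function.comp_apply, i.injective.eq_iff]
  constructor
  · rintro ⟨hlt, heq⟩
    have hx := (blockOf_eq_iff hV x _).1 rfl
    have hy := (blockOf_eq_iff hV y _).1 heq.symm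
    have hblock := fst_lt_snd_of_mem hV (blockOf hV x).2
    have hxy : (x, y) = (blockOf hV x).1 := by grind
    exact hxy ▸ (blockOf hV x).2
  · intro h
    exact ⟨fst_lt_snd_of_mem hV h,
      (blockOf_fst hV ⟨(x, y), h⟩).trans (blockOf_snd hV ⟨(x, y), h⟩).symm⟩

theorem exists_embedding_of_kernelPairs_eq (hV : V ∈ pairPartitions m) {j : Fin m → α}
    (h : kernelPairs j = V) : ∃ i : V ↪ α, i ∘ blockOf hV = j := by
  have hmem (x y : Fin m) : (x, y) ∈ V ↔ x < y ∧ j x = j y := by rw [← h, mem_kernelPairs]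
  have hfst (p q : V) (hlt : p.1.1 < q.1.1) : j p.1.1 ≠ j q.1.1 := fun heq =>
    fst_ne_snd_of_mem hV q ⟨_, (hmem _ _).2 ⟨hlt, heq⟩⟩ rfl
  refine ⟨⟨fun p => j p.1.1, fun p q heq => ?_⟩, ?_⟩
  · rcases lt_trichotomy p.1.1 q.1.1 with hlt | hfst_eq | hlt
    · exact absurd heq (hfst p q hlt)
    · exact block_eq_of_fst_eq hV hfst_eq
    · exact absurd heq.symm (hfst q p hlt)
  · funext k
    change j (blockOf hV k).1.1 = j k
    rcases (blockOf_eq_iff hV k (blockOf hV k)).1 rfl with hk | hk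
    · rw [← hk]
    · exact ((hmem _ _).1 (blockOf hV k).2).2.trans (congrArg j hk.symm)

theorem sum_kernelPairs_mem_pairPartitions {M : Type*} [AddCommMonoid M] [Fintype α]
    (F : (Fin m → α) → M) :
    ∑ j ∈ Finset.univ.filter (fun j : Fin m → α => kernelPairs j ∈ pairPartitions m), F j =
      ∑ V : pairPartitions m, ∑ i : V.1 ↪ α, F (i ∘ blockOf V.2) := by
  rw [← Finset.sum_fiberwise_of_maps_to (t := pairPartitions m) (g := kernelPairs)
    fun j hj => (Finset.mem_filter.1 hj).2, ← Finset.sum_coe_sort]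
  refine Finset.sum_congr rfl fun V _ => ?_
  refine (Finset.sum_bij (fun (i : V.1 ↪ α) _ => i ∘ blockOf V.2) ?_ ?_ ?_ ?_).symm
  · intro i _
    simp [kernelPairs_comp_blockOf]
  · intro i _ i' _ h
    exact DFunLike.coe_injective ((blockOf_surjective V.2).injective_comp_right h)
  · intro j hj
    obtain ⟨i, hi⟩ := exists_embedding_of_kernelPairs_eq V.2 (Finset.mem_filter.1 hj).2
    exact ⟨i, Finset.mem_univ _, hi⟩
  · intro i _
    rfl

end PairPartitions

section PairingWeights

variable {m : ℕ} {V : Finset (Fin m × Fin m)}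

/-- The product of the inversion factors of the four pairs of positions with the first position in
the block `r.1` and the second one in the block `r.2`. -/
def blockInversionFactor (c : Expo → Expo → ℕ → ℕ → ℝ) (j : Fin m → ℕ) (ε : Fin m → Expo)
    (r : V × V) : ℝ :=
  inversionFactor c j ε r.1.1.1 r.2.1.1 * inversionFactor c j ε r.1.1.1 r.2.1.2 *
    (inversionFactor c j ε r.1.1.2 r.2.1.1 * inversionFactor c j ε r.1.1.2 r.2.1.2)

theorem wordWeight_comp_blockOf (hV : V ∈ pairPartitions m) (c : Expo → Expo → ℕ → ℕ → ℝ)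
    (i : V → ℕ) (ε : Fin m → Expo) :
    wordWeight c (i ∘ blockOf hV) ε =
      ∏ r ∈ orderedBlockPairs V, blockInversionFactor c (i ∘ blockOf hV) ε r *
        blockInversionFactor c (i ∘ blockOf hV) ε r.swap := by
  rw [← prod_block_pairs hV fun r => blockInversionFactor c (i ∘ blockOf hV) ε r]
  · rw [wordWeight, prod_eq_prod_blocks hV, Fintype.prod_prod_type]
    refine Finset.prod_congr rfl fun p _ => ?_
    rw [prod_eq_prod_blocks hV, prod_eq_prod_blocks hV, ← Finset.prod_mul_distrib]
    rfl
  · intro p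
    simp [blockInversionFactor, inversionFactor, blockOf_fst, blockOf_snd]

/-- The contribution of two blocks with the indices `i r.1` and `i r.2` to the weight of a pairing,
where `y` is the coefficient attached to the two indices. -/
noncomputable def pairWeight (t : ℝ) (i : V ↪ ℕ) (r : V × V) (y : ℝ) : ℝ :=
  if Crosses r then t * y
  else if Nests r then (if i r.1 < i r.2 then t * y ^ 2 else t)
  else 1

theorem commCoeff_of_lt (t : ℝ) (μ : ℕ → ℕ → ℝ) {k l : ℕ} (h : k < l) (e e' : Expo) :
    commCoeff t μ e e' k l = upperCoeff t (μ k l) e e' :=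
  if_pos h

theorem blockInversionFactor_mul_swap (hV : V ∈ pairPartitions m) (i : V ↪ ℕ)
    {ε : Fin m → Expo} (hε : ∀ p ∈ V, ε p.1 = Expo.one ∧ ε p.2 = Expo.adj) {t : ℝ} (ht : t ≠ 0)
    {μ : ℕ → ℕ → ℝ} (hμ : ∀ k l, k < l → μ k l ≠ 0) {r : V × V} (hr : r ∈ orderedBlockPairs V) :
    blockInversionFactor (commCoeff t μ) (i ∘ blockOf hV) ε r *
        blockInversionFactor (commCoeff t μ) (i ∘ blockOf hV) ε r.swap =
      pairWeight t i r (μ (min (i r.1) (i r.2)) (max (i r.1) (i r.2))) := by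
  obtain ⟨p, p'⟩ := r
  have hww' : p.1.1 < p'.1.1 := fst_lt_fst_of_mem_orderedBlockPairs hr
  have hwz' : p'.1.1 < p'.1.2 := fst_lt_snd_of_mem hV p'.2
  have hwz : p.1.1 < p'.1.2 := hww'.trans hwz'
  have hzz' : p.1.2 ≠ p'.1.2 := fun h => hww'.ne (by rw [block_eq_of_snd_eq hV h])
  obtain ⟨hw, hz⟩ := hε p.1 p.2
  obtain ⟨hw', hz'⟩ := hε p'.1 p'.2
  simp only [blockInversionFactor, inversionFactor, Function.comp_apply, blockOf_fst, blockOf_snd,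
    hw, hz, hw', hz', Prod.fst_swap, Prod.snd_swap, pairWeight, Crosses, Nests, hww', hww'.not_gt,
    hwz', hwz, hwz.not_gt, true_and, false_and, if_false]
  -- With `w < z` and `w' < z'` the two blocks and `y` the coefficient: if `i p < i p'`, only
  -- `(w', z)` and `(z', z)` can be inversions, with the factors `t * y` and `y`; if `i p' < i p`,
  -- only `(w, w')`, `(w, z')`, `(z, w')`, `(z, z')` can, with the factors `1 / y`, `t * y`,
  -- `1 / (t * y)`, `y`.
  rcases lt_or_gt_of_ne (i.injective.ne fun h : p = p' => hww'.ne (by rw [h])) with h | h <;>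
    have hy := hμ _ _ h <;>
    rcases lt_or_gt_of_ne (fst_ne_snd_of_mem hV p' p) with hwz₂ | hwz₂
  · rcases lt_or_gt_of_ne hzz' with hzz | hzz
    · simp [h, h.le, h.not_gt, hwz₂, hwz₂.not_gt, hzz, hzz.not_gt, commCoeff_of_lt, upperCoeff]
    · simp only [h, h.le, h.not_gt, hwz₂, hwz₂.not_gt, hzz, hzz.not_gt, commCoeff_of_lt, upperCoeff,
        if_true, if_false, and_self, and_false, mul_one, one_mul, inf_of_le_left, sup_of_le_right]
      ring
  · simp [h.not_gt, hwz₂.not_gt, (hwz₂.trans hwz').not_gt]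
  · rcases lt_or_gt_of_ne hzz' with hzz | hzz
    · simp only [h, h.le, h.not_gt, hwz₂, hwz₂.not_gt, hzz, commCoeff_of_lt, upperCoeff,
        if_true, if_false, and_self, and_true, and_false, mul_one, one_mul, inf_of_le_right,
        sup_of_le_left]
      field_simp
    · simp only [h, h.not_gt, hwz₂, hwz₂.not_gt, hzz, hzz.not_gt, commCoeff_of_lt, upperCoeff,
        if_true, if_false, and_true, and_false, mul_one]
      field_simp
  · simp only [h, h.not_gt, hwz₂, hwz₂.not_gt, hwz₂.trans hwz', (hwz₂.trans hwz').not_gt,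
      commCoeff_of_lt, upperCoeff, if_true, if_false, and_self, and_true, mul_one]
    field_simp

theorem wordWeight_pairing (hV : V ∈ pairPartitions m) (i : V ↪ ℕ)
    {ε : Fin m → Expo} (hε : ∀ p ∈ V, ε p.1 = Expo.one ∧ ε p.2 = Expo.adj) {t : ℝ} (ht : t ≠ 0)
    {μ : ℕ → ℕ → ℝ} (hμ : ∀ k l, k < l → μ k l ≠ 0) :
    wordWeight (commCoeff t μ) (i ∘ blockOf hV) ε =
      ∏ r ∈ orderedBlockPairs V,
        pairWeight t i r (μ (min (i r.1) (i r.2)) (max (i r.1) (i r.2))) := by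
  rw [wordWeight_comp_blockOf]
  exact Finset.prod_congr rfl fun r hr => blockInversionFactor_mul_swap hV i hε ht hμ hr

end PairingWeights

section Moments

variable {m : ℕ} {V : Finset (Fin m × Fin m)} {A : Type*} [Ring A] [StarRing A] [Algebra ℂ A]
  {φ : A →ₗ[ℂ] ℂ} {b : ℕ → A} {c : Expo → Expo → ℕ → ℕ → ℝ}

theorem map_subword_pairing (hb : MomentCondition φ b) (hV : V ∈ pairPartitions m) (i : V ↪ ℕ)
    (ε : Fin m → Expo) (p : V) :
    φ (subword b (i ∘ blockOf hV) ε (i p)) =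
      φ (epow (b 0) (ε p.1.1) * epow (b 0) (ε p.1.2)) := by
  rw [subword, finRange_filter_eq (l := [p.1.1, p.1.2])]
  · simpa using hb.cov_eq (i p) 0 (ε p.1.1) (ε p.1.2)
  · simpa using fst_lt_snd_of_mem hV p.2
  · simp [blockOf_eq_iff]

theorem map_word_pairing (hb : MomentCondition φ b) (hc : CommutationRelation c b)
    (hV : V ∈ pairPartitions m) (i : V ↪ ℕ) (ε : Fin m → Expo) :
    φ (word b (i ∘ blockOf hV) ε) =
      wordWeight c (i ∘ blockOf hV) ε *
        ∏ p ∈ V, φ (epow (b 0) (ε p.1) * epow (b 0) (ε p.2)) := by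
  have himage : Finset.univ.image (i ∘ blockOf hV) = Finset.univ.image i := by
    rw [← Finset.image_image, Finset.image_univ_of_surjective (blockOf_surjective hV)]
  rw [map_word hb.factors hc, himage, Finset.prod_image i.injective.injOn, ← Finset.prod_coe_sort V]
  congr 1
  exact Finset.prod_congr rfl fun p _ => map_subword_pairing hb hV i ε p

theorem prod_cov_eq_zero_or (hb : MomentCondition φ b) (V : Finset (Fin m × Fin m))
    (ε : Fin m → Expo) :
    (∏ p ∈ V, φ (epow (b 0) (ε p.1) * epow (b 0) (ε p.2))) = 0 ∨
      ∀ p ∈ V, ε p.1 = Expo.one ∧ ε p.2 = Expo.adj := by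
  refine or_iff_not_imp_left.2 fun h p hp => ?_
  have hp := Finset.prod_ne_zero_iff.1 h p hp
  rcases hw : ε p.1 with _ | _ <;> rcases hz : ε p.2 with _ | _ <;> rw [hw, hz] at hp
  · exact absurd (hb.mul_self 0) hp
  · exact ⟨rfl, rfl⟩
  · exact absurd (hb.star_mul_self 0) hp
  · exact absurd (hb.star_mul_star 0) hp

theorem epow_partialSum [StarModule ℂ A] (b : ℕ → A) (N : ℕ) (e : Expo) :
    epow (partialSum b N) e = ((1 / Real.sqrt N : ℝ) : ℂ) • ∑ i : Fin N, epow (b i) e := by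
  cases e
  · simp only [epow, partialSum, Finset.sum_range]
  · simp only [epow, partialSum, Finset.sum_range, star_smul, star_sum, Complex.star_def,
      Complex.conj_ofReal]

theorem starMoment_partialSum [StarModule ℂ A] (φ : A →ₗ[ℂ] ℂ) (b : ℕ → A) (N : ℕ)
    (ε : Fin m → Expo) :
    starMoment φ (partialSum b N) ε = ((1 / Real.sqrt N : ℝ) : ℂ) ^ m *
      ∑ j : Fin m → Fin N, φ (word b (fun k => j k) ε) := by
  have hexpand := (MultilinearMap.mkPiAlgebraFin ℂ m A).map_sum fun k (i : Fin N) =>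
    epow (b i) (ε k)
  simp only [MultilinearMap.mkPiAlgebraFin_apply] at hexpand
  have hscale := (MultilinearMap.mkPiAlgebraFin ℂ m A).map_smul_univ
    (fun _ => ((1 / Real.sqrt N : ℝ) : ℂ)) fun k => ∑ i : Fin N, epow (b i) (ε k)
  simp only [MultilinearMap.mkPiAlgebraFin_apply, Finset.prod_const, Finset.card_univ,
    Fintype.card_fin] at hscale
  simp only [starMoment, epow_partialSum]
  rw [hscale, hexpand, map_smul, map_sum, smul_eq_mul]
  rfl

theorem two_mul_card_image_lt_of_map_word_ne_zero (hb : MomentCondition φ b)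
    (hc : CommutationRelation c b) {N : ℕ} {j : Fin m → Fin N} {ε : Fin m → Expo}
    (hj : kernelPairs j ∉ pairPartitions m) (hne : φ (word b (fun k => j k) ε) ≠ 0) :
    2 * (Finset.univ.image j).card < m := by
  by_contra! hcard
  refine hj (kernelPairs_mem_pairPartitions
    (card_fiber_eq_of_card_le_mul_card_image (fun k₀ => ?_) (by simpa using hcard)))
  by_contra! hlt
  refine hne (map_word_eq_zero_of_forall_eq hb hc _ ε (k₀ := k₀) fun k hk => ?_)
  exact Finset.card_le_one.1 (Nat.le_of_lt_succ hlt) k (by simpa [Fin.ext_iff] using hk) k₀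
    (by simp)

theorem norm_sum_map_word_le (hb : MomentCondition φ b) (hc : CommutationRelation c b)
    [NeZero m] {r : ℕ} (hr : m ≤ 2 * (r + 1)) {C : ℝ} {ε : Fin m → Expo}
    (hC : ∀ j, ‖φ (word b j ε)‖ ≤ C) (N : ℕ) :
    ‖∑ j ∈ Finset.univ.filter (fun j : Fin m → Fin N => kernelPairs j ∉ pairPartitions m),
      φ (word b (fun k => j k) ε)‖ ≤ r ^ m * N ^ r * C := by
  have hcard : ∀ j ∈ Finset.univ.filter
      (fun j : Fin m → Fin N => kernelPairs j ∉ pairPartitions m),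
      φ (word b (fun k => j k) ε) ≠ 0 → (Finset.univ.image j).card ≤ r := by
    intro j hj hne
    have := two_mul_card_image_lt_of_map_word_ne_zero hb hc (Finset.mem_filter.1 hj).2 hne
    omega
  have hcount := (Finset.card_le_card (Finset.filter_subset_filter _ (Finset.filter_subset
    (fun j : Fin m → Fin N => kernelPairs j ∉ pairPartitions m) Finset.univ))).trans
      (card_filter_card_image_le r)
  rw [Fintype.card_fin, Fintype.card_fin] at hcount
  have hC₀ : 0 ≤ C := (norm_nonneg _).trans (hC fun _ => 0)
  rw [← Finset.sum_filter_of_ne hcard]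
  refine (norm_sum_le_of_le _ fun j _ => hC fun k => j k).trans ?_
  rw [Finset.sum_const, nsmul_eq_mul]
  exact mul_le_mul_of_nonneg_right (mod_cast hcount) hC₀

theorem tendsto_inv_sqrt_pow_mul_pow {m r : ℕ} (h : 2 * r < m) :
    Tendsto (fun N : ℕ => (1 / Real.sqrt N) ^ m * (N : ℝ) ^ r) atTop (𝓝 0) := by
  obtain ⟨d, rfl⟩ := Nat.exists_eq_add_of_lt h
  have hsqrt : Tendsto (fun N : ℕ => 1 / Real.sqrt N) atTop (𝓝 0) := by
    simpa only [one_div, Function.comp_def] using tendsto_inv_atTop_zero.comp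
      (Real.tendsto_sqrt_atTop.comp tendsto_natCast_atTop_atTop)
  have hpow : Tendsto (fun N : ℕ => (1 / Real.sqrt N) ^ (d + 1)) atTop (𝓝 0) := by
    simpa using hsqrt.pow (d + 1)
  refine hpow.congr' ?_
  filter_upwards [eventually_gt_atTop 0] with N hN
  have hN' : (0 : ℝ) < N := Nat.cast_pos.2 hN
  have hsq : (1 / Real.sqrt N) ^ 2 * N = 1 := by
    rw [div_pow, Real.sq_sqrt hN'.le, one_pow, one_div_mul_cancel hN'.ne']
  calc (1 / Real.sqrt N) ^ (d + 1)
      = ((1 / Real.sqrt N) ^ 2 * N) ^ r * (1 / Real.sqrt N) ^ (d + 1) := by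
        rw [hsq, one_pow, one_mul]
    _ = (1 / Real.sqrt N) ^ (2 * r + d + 1) * (N : ℝ) ^ r := by ring

theorem tendsto_sum_not_pairing (hb : MomentCondition φ b) (hc : CommutationRelation c b)
    (ε : Fin m → Expo) :
    Tendsto (fun N : ℕ => ((1 / Real.sqrt N : ℝ) : ℂ) ^ m *
      ∑ j ∈ Finset.univ.filter (fun j : Fin m → Fin N => kernelPairs j ∉ pairPartitions m),
        φ (word b (fun k => j k) ε)) atTop (𝓝 0) := by
  rcases eq_or_ne m 0 with rfl | hm
  · have hmem (N : ℕ) (j : Fin 0 → Fin N) : kernelPairs j ∈ pairPartitions 0 :=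
      kernelPairs_mem_pairPartitions fun k => k.elim0
    simp [hmem]
  have : NeZero m := ⟨hm⟩
  obtain ⟨C, hC⟩ := hb.bounded m
  have hlim := (tendsto_inv_sqrt_pow_mul_pow (m := m) (r := (m - 1) / 2) (by omega)).const_mul
    (((m - 1) / 2 : ℕ) ^ m * C : ℝ)
  rw [mul_zero] at hlim
  refine squeeze_zero_norm (fun N => ?_) hlim
  rw [norm_mul, norm_pow, Complex.norm_real, Real.norm_of_nonneg (by positivity)]
  refine (mul_le_mul_of_nonneg_left (norm_sum_map_word_le hb hc (r := (m - 1) / 2) (by omega)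
    (fun j => hC j ε) N) (by positivity)).trans_eq ?_
  ring

theorem inv_sqrt_pow_eq (hV : V ∈ pairPartitions m) (N : ℕ) :
    (1 / Real.sqrt N) ^ m = ((N : ℝ) ^ Fintype.card V)⁻¹ := by
  calc (1 / Real.sqrt N) ^ m
      = ((1 / Real.sqrt N) ^ 2) ^ V.card := by
        rw [← pow_mul, two_mul_card_of_mem_pairPartitions hV]
    _ = ((N : ℝ) ^ Fintype.card V)⁻¹ := by
        rw [div_pow, one_pow, Real.sq_sqrt (Nat.cast_nonneg N), one_div, inv_pow, Fintype.card_coe]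

/-- The only asymptotic property of the coefficients `μ` that enters the moments: the weight of the
pairing `V`, averaged over all assignments of distinct indices to its blocks, tends to the weight
of `V` in the limit law. -/
def PairWeightsConverge (q t : ℝ) (μ : ℕ → ℕ → ℝ) {m : ℕ} (V : Finset (Fin m × Fin m)) : Prop :=
  Tendsto (fun N : ℕ => tupleSum N (fun i : V ↪ ℕ => ∏ r ∈ orderedBlockPairs V,
    pairWeight t i r (μ (min (i r.1) (i r.2)) (max (i r.1) (i r.2)))) /
      (N : ℝ) ^ Fintype.card V) atTop (𝓝 (q ^ crossings V * t ^ nestings V))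

variable {q t : ℝ} {μ : ℕ → ℕ → ℝ}

theorem PairWeightsConverge.tendsto_sum_map_word (hlim : PairWeightsConverge q t μ V)
    (hb : MomentCondition φ b) (ht : t ≠ 0) (hμ : ∀ k l, k < l → μ k l ≠ 0)
    (hc : CommutationRelation (commCoeff t μ) b) (hV : V ∈ pairPartitions m) (ε : Fin m → Expo) :
    Tendsto (fun N : ℕ => ((1 / Real.sqrt N : ℝ) : ℂ) ^ m *
      ∑ i : V ↪ Fin N, φ (word b (fun k => i (blockOf hV k)) ε)) atTop
      (𝓝 ((q : ℂ) ^ crossings V * (t : ℂ) ^ nestings V *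
        ∏ p ∈ V, φ (epow (b 0) (ε p.1) * epow (b 0) (ε p.2)))) := by
  have hword {N : ℕ} (i : V ↪ Fin N) : _ :=
    map_word_pairing hb hc hV (i.trans Fin.valEmbedding) ε
  simp only [Function.comp_def, Function.Embedding.trans_apply, Fin.valEmbedding_apply] at hword
  simp only [hword]
  rcases prod_cov_eq_zero_or hb V ε with hzero | hε
  · simp [hzero]
  have hcast := ((Complex.continuous_ofReal.tendsto _).comp hlim).mul_const
    (∏ p ∈ V, φ (epow (b 0) (ε p.1) * epow (b 0) (ε p.2)))
  simp only [Complex.ofReal_mul, Complex.ofReal_pow] at hcast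
  refine hcast.congr fun N => ?_
  rw [← Finset.sum_mul, ← mul_assoc, ← Complex.ofReal_pow, inv_sqrt_pow_eq hV,
    ← Complex.ofReal_sum, ← Complex.ofReal_mul, inv_mul_eq_div]
  simp only [Function.comp_apply, tupleSum, ← wordWeight_pairing hV _ hε ht hμ]
  rfl

theorem tendsto_starMoment_partialSum [StarModule ℂ A] (hb : MomentCondition φ b) (ht : t ≠ 0)
    (hμ : ∀ k l, k < l → μ k l ≠ 0) (hc : CommutationRelation (commCoeff t μ) b)
    (hlim : ∀ V ∈ pairPartitions m, PairWeightsConverge q t μ V) (ε : Fin m → Expo) :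
    Tendsto (fun N => starMoment φ (partialSum b N) ε) atTop
      (𝓝 (∑ V ∈ pairPartitions m, (q : ℂ) ^ crossings V * (t : ℂ) ^ nestings V *
        ∏ p ∈ V, φ (epow (b 0) (ε p.1) * epow (b 0) (ε p.2)))) := by
  have hpair := tendsto_finsetSum Finset.univ fun (V : pairPartitions m) _ =>
    (hlim V.1 V.2).tendsto_sum_map_word hb ht hμ hc V.2 ε
  rw [Finset.sum_coe_sort (pairPartitions m) fun V =>
    (q : ℂ) ^ crossings V * (t : ℂ) ^ nestings V *
      ∏ p ∈ V, φ (epow (b 0) (ε p.1) * epow (b 0) (ε p.2))] at hpair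
  have hsum := hpair.add (tendsto_sum_not_pairing hb hc ε)
  rw [add_zero] at hsum
  refine hsum.congr fun N => ?_
  rw [starMoment_partialSum, ← Finset.mul_sum, ← mul_add,
    ← Finset.sum_filter_add_sum_filter_not Finset.univ
      (fun j : Fin m → Fin N => kernelPairs j ∈ pairPartitions m),
    sum_kernelPairs_mem_pairPartitions]
  rfl

end Moments

section RandomWeights

variable {m : ℕ} {V : Finset (Fin m × Fin m)}

theorem measurable_pairWeight (t : ℝ) (i : V ↪ ℕ) (r : V × V) : Measurable (pairWeight t i r) := by
  unfold pairWeight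
  split_ifs <;> fun_prop

theorem abs_pairWeight_le (t : ℝ) (i : V ↪ ℕ) (r : V × V) (y : ℝ) :
    |pairWeight t i r y| ≤ (1 + |t|) * (1 + y ^ 2) := by
  have hy : |y| ≤ 1 + y ^ 2 := by nlinarith [sq_nonneg (|y| - 1), sq_abs y, abs_nonneg y]
  have ht : 0 ≤ |t| := abs_nonneg t
  have hsq : 0 ≤ y ^ 2 := sq_nonneg y
  unfold pairWeight
  split_ifs
  · rw [abs_mul]
    nlinarith
  · rw [abs_mul, abs_of_nonneg hsq]
    nlinarith
  · nlinarith
  · rw [abs_one]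
    nlinarith

theorem integral_pairWeight {ν : Measure ℝ} [IsProbabilityMeasure ν] {q t : ℝ} (ht : t ≠ 0)
    (hmean : ∫ x, x ∂ν = q / t) (hsq : ∫ x, x ^ 2 ∂ν = 1) (i : V ↪ ℕ) (r : V × V) :
    ∫ x, pairWeight t i r x ∂ν = if Crosses r then q else if Nests r then t else 1 := by
  unfold pairWeight
  split_ifs
  · rw [integral_const_mul, hmean, mul_div_cancel₀ _ ht]
  · rw [integral_const_mul, hsq, mul_one]
  · simp
  · simp

/-- The edge of the complete graph on the blocks of `V` that joins the two blocks. -/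
def blockEdge (r : orderedBlockPairs V) : (⊤ : SimpleGraph V).edgeSet :=
  ⟨s(r.1.1, r.1.2), fun h => (fst_lt_fst_of_mem_orderedBlockPairs r.2).ne (by rw [h])⟩

theorem blockEdge_injective : Function.Injective (blockEdge (V := V)) := by
  rintro ⟨⟨p, p'⟩, hp⟩ ⟨⟨s, s'⟩, hs⟩ h
  rcases Sym2.eq_iff.1 (congrArg Subtype.val h) with ⟨rfl, rfl⟩ | ⟨rfl, rfl⟩
  · rfl
  · exact absurd (fst_lt_fst_of_mem_orderedBlockPairs hp)
      (fst_lt_fst_of_mem_orderedBlockPairs hs).not_gt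

theorem inf_lt_sup_of_mem_edgeSet_top {e : Sym2 ℕ} (he : e ∈ (⊤ : SimpleGraph ℕ).edgeSet) :
    e.inf < e.sup := by
  induction e with
  | h a b => exact inf_lt_sup.2 ((SimpleGraph.mem_edgeSet _).1 he).ne

variable {Ω : Type*} [MeasurableSpace Ω] {P : Measure Ω} {μ : ℕ → ℕ → Ω → ℝ}

theorem iIndepFun_edgeWeight
    (hind : iIndepFun (fun p : {p : ℕ × ℕ // p.1 < p.2} => μ p.1.1 p.1.2) P) :
    iIndepFun (fun e : (⊤ : SimpleGraph ℕ).edgeSet => μ e.1.inf e.1.sup) P := by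
  let toPair (e : (⊤ : SimpleGraph ℕ).edgeSet) : {p : ℕ × ℕ // p.1 < p.2} :=
    ⟨(e.1.inf, e.1.sup), inf_lt_sup_of_mem_edgeSet_top e.2⟩
  have htoPair : Function.Injective toPair := fun e e' h =>
    Subtype.ext (Sym2.inf_eq_inf_and_sup_eq_sup.1 (Prod.ext_iff.1 (congrArg Subtype.val h)))
  exact hind.precomp htoPair

theorem ae_pairWeightsConverge {q t : ℝ} (ht : t ≠ 0) {ν : Measure ℝ}
    (hmeas : ∀ k l, k < l → Measurable (μ k l))
    (hind : iIndepFun (fun p : {p : ℕ × ℕ // p.1 < p.2} => μ p.1.1 p.1.2) P)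
    (hlaw : ∀ k l, k < l → HasLaw (μ k l) ν P) (hmean : ∫ x, x ∂ν = q / t)
    (hsq : ∫ x, x ^ 2 ∂ν = 1) (V : Finset (Fin m × Fin m)) :
    ∀ᵐ ω ∂P, PairWeightsConverge q t (fun k l => μ k l ω) V := by
  have := hind.isProbabilityMeasure
  have : IsProbabilityMeasure ν := (hlaw 0 1 one_pos).isProbabilityMeasure_iff.1 ‹_›
  have hdominated : ∫⁻ x, ENNReal.ofReal ((1 + |t|) * (1 + x ^ 2)) ∂ν ≠ ∞ := by
    have hsq_int : Integrable (fun x : ℝ => x ^ 2) ν := .of_integral_ne_zero (by simp [hsq])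
    exact (((integrable_const _).add hsq_int).const_mul _).lintegral_lt_top.ne
  have hlln := strong_law_ae_tupleSum_prod_edges
    (X := fun e : (⊤ : SimpleGraph ℕ).edgeSet => μ e.1.inf e.1.sup)
    (fun e => hmeas _ _ (inf_lt_sup_of_mem_edgeSet_top e.2)) (iIndepFun_edgeWeight hind)
    (fun e => hlaw _ _ (inf_lt_sup_of_mem_edgeSet_top e.2)) (blockEdge_injective (V := V))
    (g := fun i r => pairWeight t i r) (fun i r => measurable_pairWeight t i r)
    (G := fun x => ENNReal.ofReal ((1 + |t|) * (1 + x ^ 2))) (by fun_prop)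
    (fun i r x => ?_) hdominated (fun i r => integral_pairWeight ht hmean hsq i r.1)
  · filter_upwards [hlln] with ω hω
    rw [Finset.prod_coe_sort (orderedBlockPairs V)
      fun r => if Crosses r then q else if Nests r then t else 1, prod_orderedBlockPairs_eq] at hω
    refine hω.congr fun N => ?_
    congr 2
    funext i
    exact Finset.prod_coe_sort (orderedBlockPairs V) fun r =>
      pairWeight t i r (μ (min (i r.1) (i r.2)) (max (i r.1) (i r.2)) ω)
  · rw [Real.enorm_eq_ofReal_abs]
    exact ENNReal.ofReal_le_ofReal (abs_pairWeight_le t i r x)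

end RandomWeights

end NCCLT

open NCCLT in
theorem theorem1p4_general {Ω : Type v} [MeasurableSpace Ω] (P : Measure Ω) {q t : ℝ} (ht : t ≠ 0)
    (μ : ℕ → ℕ → Ω → ℝ)
    (hmeas : ∀ i j, i < j → Measurable (μ i j))
    (hindep : iIndepFun (fun p : {p : ℕ × ℕ // p.1 < p.2} => μ p.1.1 p.1.2) P)
    (hident : ∀ i j k l, i < j → k < l → IdentDistrib (μ i j) (μ k l) P P)
    (hne : ∀ i j, i < j → ∀ᵐ ω ∂P, μ i j ω ≠ 0)
    (hmean : ∀ i j, i < j → ∫ ω, μ i j ω ∂P = q / t)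
    (hsq : ∀ i j, i < j → ∫ ω, μ i j ω ^ 2 ∂P = 1) :
    ∀ᵐ ω ∂P, ∀ (A : Type u) [Ring A] [StarRing A] [Algebra ℂ A] [StarModule ℂ A]
      (φ : A →ₗ[ℂ] ℂ) (b : ℕ → A),
      MomentCondition φ b →
      CommutationRelation (commCoeff t (fun i j => μ i j ω)) b →
      ∀ (m : ℕ) (ε : Fin m → Expo),
        Tendsto (fun N => starMoment φ (partialSum b N) ε) atTop
          (𝓝 (∑ V ∈ pairPartitions m, (q : ℂ) ^ crossings V * (t : ℂ) ^ nestings V *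
            ∏ p ∈ V, φ (epow (b 0) (ε p.1) * epow (b 0) (ε p.2)))) := by
  have hμ : Measurable (μ 0 1) := hmeas 0 1 one_pos
  have hlaw (k l : ℕ) (h : k < l) : HasLaw (μ k l) (P.map (μ 0 1)) P :=
    ⟨(hmeas k l h).aemeasurable, (hident k l 0 1 h one_pos).map_eq⟩
  have hmean' : ∫ x, x ∂P.map (μ 0 1) = q / t := by
    rw [integral_map hμ.aemeasurable (by fun_prop), hmean 0 1 one_pos]
  have hsq' : ∫ x, x ^ 2 ∂P.map (μ 0 1) = 1 := by
    rw [integral_map hμ.aemeasurable (by fun_prop), hsq 0 1 one_pos]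
  have hlim : ∀ᵐ ω ∂P, ∀ (m : ℕ) (V : Finset (Fin m × Fin m)),
      PairWeightsConverge q t (fun k l => μ k l ω) V :=
    ae_all_iff.2 fun m => ae_all_iff.2
      (ae_pairWeightsConverge ht hmeas hindep hlaw hmean' hsq')
  have hne' : ∀ᵐ ω ∂P, ∀ k l, k < l → μ k l ω ≠ 0 := by simpa only [ae_all_iff] using hne
  filter_upwards [hlim, hne'] with ω hω hωne
  intro A _ _ _ _ φ b hb hc m ε
  exact tendsto_starMoment_partialSum hb ht hωne hc (fun V _ => hω m V) ε

theorem theorem1p4 {Ω : Type v} [MeasurableSpace Ω] (P : Measure Ω) [IsProbabilityMeasure P]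
    (q t : ℝ) (ht : 0 < t)
    (μ : ℕ → ℕ → Ω → ℝ)
    (hmeas : ∀ i j, i < j → Measurable (μ i j))
    (hindep : iIndepFun (fun p : {p : ℕ × ℕ // p.1 < p.2} => μ p.1.1 p.1.2) P)
    (hident : ∀ i j k l, i < j → k < l → IdentDistrib (μ i j) (μ k l) P P)
    (hne : ∀ i j, i < j → ∀ᵐ ω ∂P, μ i j ω ≠ 0)
    (hint : ∀ i j, i < j → Integrable (μ i j) P)
    (hint2 : ∀ i j, i < j → Integrable (fun ω => μ i j ω ^ 2) P)
    (hmean : ∀ i j, i < j → ∫ ω, μ i j ω ∂P = q / t)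
    (hsq : ∀ i j, i < j → ∫ ω, μ i j ω ^ 2 ∂P = 1) :
    ∀ᵐ ω ∂P, ∀ (A : Type u) [Ring A] [StarRing A] [Algebra ℂ A] [StarModule ℂ A]
      (φ : A →ₗ[ℂ] ℂ) (b : ℕ → A),
      NCCLT.IsState φ →
      NCCLT.MomentCondition φ b →
      NCCLT.CommutationRelation (NCCLT.commCoeff t (fun i j => μ i j ω)) b →
      (∀ (n : ℕ) (ε : Fin (2 * n + 1) → NCCLT.Expo),
        Tendsto (fun N => NCCLT.starMoment φ (NCCLT.partialSum b N) ε) atTop (𝓝 0)) ∧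
      (∀ (n : ℕ) (ε : Fin (2 * n) → NCCLT.Expo),
        Tendsto (fun N => NCCLT.starMoment φ (NCCLT.partialSum b N) ε) atTop
          (𝓝 (∑ V ∈ NCCLT.pairPartitions (2 * n),
            (q : ℂ) ^ NCCLT.crossings V * (t : ℂ) ^ NCCLT.nestings V *
              ∏ p ∈ V, φ (NCCLT.epow (b 0) (ε p.1) * NCCLT.epow (b 0) (ε p.2))))) := by
  filter_upwards [theorem1p4_general P ht.ne' μ hmeas hindep hident hne hmean hsq] with ω hω
  intro A _ _ _ _ φ b _ hb hc
  refine ⟨fun n ε => ?_, fun n ε => hω A φ b hb hc (2 * n) ε⟩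
  simpa only [NCCLT.pairPartitions_odd, Finset.sum_empty] using hω A φ b hb hc (2 * n + 1) ε
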